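/- For $p\ge 3$ let $\lambda_p=2\cos(\pi/p)$. An infinite frieze pattern is an array $(m_{i,j})_{i,j\in\mathbb Z,\,j\ge i}$ of real numbers with $m_{i,i}=0$, $m_{i,i+1}=1$ and $m_{i-1,j}\,m_{i,j+1}-m_{i,j}\,m_{i-1,j+1}=1$ for all $i\le j$; its quiddity sequence is $(m_{i-1,i+1})_{i\in\mathbb Z}$. It is of Type $\Lambda_{p_1,\ldots,p_s}$ (all $p_k\ge 3$) if each $m_{i-1,i+1}$ is a combination of $\lambda_{p_1},\ldots,\lambda_{p_s}$ with non-negative integer coefficients, and skeletal if for every $p\ge 3$ each string of consecutive entries $\lambda_p$ in the quiddity sequence has length smaller than $p-2$. Let $A_{n,m}$ ($n,m\ge1$) be the annulus with $n$ marked points $v_1,\dots,v_n$ on its outer and $m$ on its inner boundary, and $S_n$ the once-punctured disc with $n$ marked points $v_1,\dots,v_n$ on its boundary. A dissection is a set of pairwise non-crossing arcs between marked points (for $S_n$, also between marked points and the puncture), none of them isotopic to a boundary segment and, for $A_{n,m}$, none of them joining two points of the inner boundary, which cuts the surface into polygons, called subgons. For a quiddity sequence of period $n$ (indices of vertices modulo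 $n$), the frieze pattern is realized by a dissection of $A_{n,m}$ or $S_n$ if, for every $i$, $m_{i-1,i+1}$ is the sum of $\lambda_{|P|}$ over the subgons $P$ incident to $v_i$, where $|P|$ is the number of edges of $P$ and $P$ is counted once for each of its corners at $v_i$. **Proposition (Skeletal Realizability Criteria).** Let $\mathcal F=\{m_{i,j}\}$ be a skeletal infinite frieze pattern of Type $\Lambda_{p_1,\ldots,p_s}$ with quiddity cycle $(m_{0,2},\ldots,m_{n-1,n+1})$, $n\ge 1$ (that is, with quiddity sequence of period $n$). Let $A_i$, $i\in\mathbb Z$, be the finite multiset of integers, all at least $3$, such that $m_{i-1,i+1}=\sum_{p\in A_i}\lambda_p$. Then $\mathcal F$ is realized by a dissection of $A_{n,m}$ for some $m\ge 1$, or by a dissection of $S_n$, if and only if both of the following hold. (i) The sequence passes the realizability test: $A_i\cap A_{i+1}\neq\emptyset$ for all $i$, and there is no $p\ge 3$ such that $A_i=\{p\}$ for more than $p-2$ consecutive indices $i$ while $A_j\ne\{p\}$ for some $j$. (ii) One can choose $p_{i,i+1}\in A_i\cap A_{i+1}$, for $i$ modulo $n$, such that for each $i$, if $|A_i|>1$ and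 $p_{i-1,i}=p_{i,i+1}$, then $\{p_{i-1,i},p_{i,i+1}\}\subseteq A_i$ as multisets. -/

import Mathlib

namespace FriezeDissection

/-- The number `λ_p = 2 cos (π / p)`. -/
noncomputable def lam (p : ℕ) : ℝ := 2 * Real.cos (Real.pi / p)

/-- The sum of `λ_p` over a multiset of polygon sizes. -/
noncomputable def lamSum (A : Multiset ℕ) : ℝ := (A.map lam).sum

/-! ### Infinite frieze patterns -/

/-- An infinite frieze pattern over `R`: an array `(m_{i,j})` with `j ≥ i`, where
`m_{i,i} = 0`, `m_{i,i+1} = 1` and every diamond with top `m_{i,j}`, left `m_{i-1,j}`,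
right `m_{i,j+1}` and bottom `m_{i-1,j+1}` has `left * right - top * bottom = 1`.
The values of `entry i j` with `j < i` are not part of the array and are unconstrained. -/
structure InfiniteFrieze (R : Type*) [CommRing R] where
  entry : ℤ → ℤ → R
  entry_self : ∀ i, entry i i = 0
  entry_succ : ∀ i, entry i (i + 1) = 1
  unimodular : ∀ i j, i ≤ j →
    entry (i - 1) j * entry i (j + 1) - entry i j * entry (i - 1) (j + 1) = 1

/-- The quiddity entry `m_{i-1,i+1}`. -/
def InfiniteFrieze.quiddity {R : Type*} [CommRing R] (F : InfiniteFrieze R) (i : ℤ) : R :=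
  F.entry (i - 1) (i + 1)

/-- Type `Λ_{p_1,…,p_s}` with `S = {p_1,…,p_s}`: every quiddity entry is a combination of
`λ_{p_1},…,λ_{p_s}` with non-negative integer coefficients. -/
def InfiniteFrieze.IsOfType (F : InfiniteFrieze ℝ) (S : Finset ℕ) : Prop :=
  ∀ i, ∃ c : ℕ → ℕ, F.quiddity i = ∑ p ∈ S, (c p : ℝ) * lam p

/-- Every string of consecutive entries `λ_p` in the quiddity sequence is shorter than
`p - 2`, for every `p ≥ 3`. -/
def InfiniteFrieze.IsSkeletal (F : InfiniteFrieze ℝ) : Prop :=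
  ∀ p : ℕ, 3 ≤ p → ∀ i : ℤ, ¬ ∀ k : ℕ, k < p - 2 → F.quiddity (i + k) = lam p

/-! ### Subgons

The boundary vertices of the universal covers used below are linearly ordered in such a way that
the order read cyclically is the order along the boundary of a disc. -/

/-- `x < y` are neighbours in the cyclic order of the finite vertex set `P`. -/
def CyclicNeighbors {V : Type*} [LinearOrder V] (P : Finset V) (x y : V) : Prop :=
  (∀ z ∈ P, ¬ (x < z ∧ z < y)) ∨ (∀ z ∈ P, x ≤ z ∧ z ≤ y)

/-- `P` is the vertex set of a subgon of a dissected disc, where `E x y` for `x < y` says that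
`x` and `y` are joined by a boundary edge or by an arc of the (non-crossing) dissection:
`P` has at least three vertices, cyclically consecutive vertices of `P` are joined, and no other
two vertices of `P` are. The number of edges of the subgon is then `P.card`. -/
def IsSubgon {V : Type*} [LinearOrder V] (E : V → V → Prop) (P : Finset V) : Prop :=
  3 ≤ P.card ∧ ∀ x ∈ P, ∀ y ∈ P, x < y → (E x y ↔ CyclicNeighbors P x y)

/-- `A` is the multiset of sizes of the subgons incident to the vertex `v`. -/
def HasSubgonSizes {V : Type*} [LinearOrder V] (E : V → V → Prop) (v : V)
    (A : Multiset ℕ) : Prop :=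
  ∃ C : Finset (Finset V), (∀ P, P ∈ C ↔ IsSubgon E P ∧ v ∈ P) ∧ A = C.val.map Finset.card

/-! ### Dissections of annuli

The annulus `A_{n,m}` is covered by an infinite strip, with lower vertices `v_i` (`i : ℤ`) over
the outer vertices, upper vertices `w_j` (`j : ℤ`) over the inner vertices, both increasing from
left to right, and deck group generated by `v_i ↦ v_{i+n}`, `w_j ↦ w_{j+m}`. An isotopy class of
arcs is an orbit of pairs of vertices, and a set of arcs is non-crossing in the annulus if and
only if all lifts are pairwise non-crossing in the strip. -/

/-- A dissection of the annulus `A_{n,m}`, given by the lifts of its arcs to the strip: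
`bridging i j` is an arc from `v_i` to `w_j`, and `peripheral a b` is an arc from `v_a` to `v_b`
with `v_a` on the left. By convention there are no peripheral arcs at the inner boundary. The arcs
cut the annulus into polygons if and only if at least one of them is bridging. -/
structure AnnulusDissection (n m : ℕ) where
  bridging : ℤ → ℤ → Prop
  peripheral : ℤ → ℤ → Prop
  bridging_deck : ∀ i j, bridging (i + n) (j + m) ↔ bridging i j
  peripheral_deck : ∀ a b, peripheral (a + n) (b + n) ↔ peripheral a b
  not_boundary : ∀ a b, peripheral a b → a + 2 ≤ b
  bridging_noncrossing : ∀ a j b k, bridging a j → bridging b k → ¬ (a < b ∧ k < j)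
  peripheral_noncrossing : ∀ a b c d, peripheral a b → peripheral c d →
    ¬ (a < c ∧ c < b ∧ b < d)
  peripheral_bridging_noncrossing : ∀ a b c j, peripheral a b → bridging c j →
    ¬ (a < c ∧ c < b)
  exists_bridging : ∃ i j, bridging i j

/-- The vertices of the strip: lower vertices from left to right, then upper vertices from right
to left. -/
abbrev StripVertex : Type := ℤ ⊕ₗ ℤᵒᵈ

/-- The lower vertex `v_i` of the strip. -/
def lowerVertex (i : ℤ) : StripVertex := toLex (Sum.inl i)

/-- For `x < y`: the vertices `x` and `y` of the strip are joined by a boundary edge or by (a lift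
of) an arc of the dissection. -/
def AnnulusDissection.Edge {n m : ℕ} (D : AnnulusDissection n m) (x y : StripVertex) : Prop :=
  match ofLex x, ofLex y with
  | Sum.inl a, Sum.inl b => b = a + 1 ∨ D.peripheral a b
  | Sum.inl a, Sum.inr j => D.bridging a (OrderDual.ofDual j)
  | Sum.inr j, Sum.inr k => OrderDual.ofDual j = OrderDual.ofDual k + 1
  | Sum.inr _, Sum.inl _ => False

/-- `A` is the multiset of sizes of the subgons at the outer vertex `v_i`. A subgon of the annulus
is counted once for each of its corners at `v_i`, that is, once for each of its lifts that contains
the chosen lift of `v_i`. -/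
def AnnulusDissection.SizesAt {n m : ℕ} (D : AnnulusDissection n m) (i : ℤ)
    (A : Multiset ℕ) : Prop :=
  HasSubgonSizes D.Edge (lowerVertex i) A

/-! ### Dissections of once-punctured discs

The once-punctured disc `S_n` is covered by an infinite strip with lower vertices `v_i` (`i : ℤ`)
and no upper vertices; the puncture becomes one vertex at infinity. -/

/-- A dissection of the once-punctured disc `S_n`, given by the lifts of its arcs:
`bridging i` is an arc from `v_i` to the puncture, `peripheral a b` is an arc from `v_a` to `v_b`
with `v_a` on the left. The arcs cut the disc into polygons if and only if at least one of them
is bridging. -/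
structure PuncturedDiscDissection (n : ℕ) where
  bridging : ℤ → Prop
  peripheral : ℤ → ℤ → Prop
  bridging_deck : ∀ i, bridging (i + n) ↔ bridging i
  peripheral_deck : ∀ a b, peripheral (a + n) (b + n) ↔ peripheral a b
  not_boundary : ∀ a b, peripheral a b → a + 2 ≤ b
  peripheral_noncrossing : ∀ a b c d, peripheral a b → peripheral c d →
    ¬ (a < c ∧ c < b ∧ b < d)
  peripheral_bridging_noncrossing : ∀ a b c, peripheral a b → bridging c → ¬ (a < c ∧ c < b)
  exists_bridging : ∃ i, bridging i

/-- For `x < y`: the vertices `x` and `y` of the strip, where `⊤` is the puncture, are joined by a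
boundary edge or by (a lift of) an arc of the dissection. -/
def PuncturedDiscDissection.Edge {n : ℕ} (D : PuncturedDiscDissection n) (x y : WithTop ℤ) : Prop :=
  (∃ a b : ℤ, x = a ∧ y = b ∧ (b = a + 1 ∨ D.peripheral a b)) ∨
    ∃ a : ℤ, x = a ∧ y = ⊤ ∧ D.bridging a

/-- `A` is the multiset of sizes of the subgons at the boundary vertex `v_i`, counted with one
contribution for each corner of a subgon at `v_i`. -/
def PuncturedDiscDissection.SizesAt {n : ℕ} (D : PuncturedDiscDissection n) (i : ℤ)
    (A : Multiset ℕ) : Prop :=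
  HasSubgonSizes D.Edge (i : WithTop ℤ) A

/-! ### Realizability -/

/-- The frieze pattern, with `n`-periodic quiddity sequence, is realized by a dissection of an
annulus `A_{n,m}` with `m ≥ 1`, or of the once-punctured disc `S_n`: every quiddity entry is the
sum of `λ_p` over the multiset of sizes of the subgons at the corresponding vertex. -/
def InfiniteFrieze.IsRealizable (F : InfiniteFrieze ℝ) (n : ℕ) : Prop :=
  (∃ m : ℕ, 1 ≤ m ∧ ∃ D : AnnulusDissection n m,
    ∀ i, ∃ A, D.SizesAt i A ∧ F.quiddity i = lamSum A) ∨
  (∃ D : PuncturedDiscDissection n,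
    ∀ i, ∃ A, D.SizesAt i A ∧ F.quiddity i = lamSum A)

/-- The sequence of multisets passes the realizability test: no two consecutive multisets are
disjoint, and unless all multisets are `{p}`, no more than `p - 2` consecutive ones are `{p}`. -/
def PassesRealizabilityTest (A : ℤ → Multiset ℕ) : Prop :=
  (¬ ∃ i, A i ∩ A (i + 1) = 0) ∧
  (¬ ∃ p : ℕ, 3 ≤ p ∧ (∃ i : ℤ, ∀ k : ℕ, k < p - 1 → A (i + k) = {p}) ∧ ∃ j, A j ≠ {p})

end FriezeDissection

/-! Necessity. In the universal cover, every boundary edge `v_i v_{i+1}` borders exactly one subgon,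
and its size serves as `p_{i,i+1}`. If the subgons at the two boundary edges of `v_i` coincide, no
other subgon meets `v_i`; so `|A_i| > 1` provides two distinct subgons, whose sizes form a
submultiset even when they are equal (`exists_sizes_at_edges`). The realization prescribes only sums
of `λ_p`, so this also requires that such a sum determine its multiset (`lamSum_injOn`), i.e. that
the `λ_p` with `p ≥ 3` be linearly independent over the integers.

Independence (`lam_coeff_eq_zero`). Let `q` be the largest index in a relation. The relation
survives every automorphism `ζ ↦ ζ ^ a` of a cyclotomic field. An alternating sum over exponents `a
= 1 + ∑ m_r`, with one perturbation `m_r` for each relevant prime `r`, factors as a product and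
kills all terms except that of `q`. What remains says that a product of chords `1 - ω_r`, rotated by
`exp (π i / q)`, is purely imaginary. Varying one `ω_r` contradicts this, except when `q` has only
the prime factors 2 and 3; those cases are settled by the size of `π / q`.

Sufficiency. No peripheral arcs are needed. Put `|A_i| - 1` bridging arcs at `v_i` and number all
arcs from left to right. The polygon containing `v_i v_{i+1}` gets size `p_{i,i+1}`; the remaining
elements of `A_i` are the sizes of the polygons in the fan at `v_i` (`exists_arcs`). Skeletality
bounds the runs of singletons, so each polygon has room for its lower edges and the two bridging
sides. The excess becomes edges on the inner boundary; if there is none at all, the inner boundary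
shrinks to the puncture. -/

namespace FriezeDissection

/-! ### Linear independence of the numbers `λ_p` -/

/-- The point `exp (2 π i x)` of the unit circle. -/
noncomputable def turn (x : ℝ) : ℂ := Complex.exp (((2 * Real.pi * x : ℝ) : ℂ) * Complex.I)

theorem turn_add (x y : ℝ) : turn (x + y) = turn x * turn y := by
  unfold turn
  rw [← Complex.exp_add]
  congr 1
  push_cast
  ring

theorem turn_int (k : ℤ) : turn k = 1 := by
  unfold turn
  rw [Complex.exp_eq_one_iff]
  exact ⟨k, by push_cast; ring⟩

theorem turn_nat (k : ℕ) : turn k = 1 := by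
  simpa using turn_int k

theorem turn_zero : turn 0 = 1 := by
  simpa using turn_int 0

theorem turn_mul_nat (x : ℝ) (k : ℕ) : turn (k * x) = turn x ^ k := by
  unfold turn
  rw [← Complex.exp_nat_mul]
  congr 1
  push_cast
  ring

theorem turn_sum {ι : Type*} (s : Finset ι) (f : ι → ℝ) :
    turn (∑ i ∈ s, f i) = ∏ i ∈ s, turn (f i) := by
  classical
  induction s using Finset.induction_on with
  | empty => simp [turn_zero]
  | insert a s ha ih => rw [Finset.sum_insert ha, Finset.prod_insert ha, turn_add, ih]

theorem turn_re (x : ℝ) : (turn x).re = Real.cos (2 * Real.pi * x) := by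
  unfold turn
  rw [Complex.exp_ofReal_mul_I_re]

theorem turn_im (x : ℝ) : (turn x).im = Real.sin (2 * Real.pi * x) := by
  unfold turn
  rw [Complex.exp_ofReal_mul_I_im]

theorem turn_ne_zero (x : ℝ) : turn x ≠ 0 := Complex.exp_ne_zero _

theorem turn_eq_one_iff (x : ℝ) : turn x = 1 ↔ ∃ k : ℤ, x = k := by
  constructor
  · intro h
    unfold turn at h
    rw [Complex.exp_eq_one_iff] at h
    obtain ⟨k, hk⟩ := h
    refine ⟨k, ?_⟩
    have h2 : ((2 * Real.pi * x : ℝ) : ℂ) = ((2 * Real.pi * k : ℝ) : ℂ) := by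
      apply mul_right_cancel₀ Complex.I_ne_zero
      rw [hk]
      push_cast
      ring
    have h3 := Complex.ofReal_injective h2
    exact mul_left_cancel₀ (by positivity) h3
  · rintro ⟨k, rfl⟩
    exact turn_int k

theorem lam_eq_turn (p : ℕ) : lam p = 2 * (turn (1 / (2 * p))).re := by
  rw [turn_re, lam]
  congr 2
  by_cases hp : (p : ℝ) = 0
  · simp [hp]
  · field_simp

theorem turn_add_turn_neg (x : ℝ) : turn x + turn (-x) = ((2 * (turn x).re : ℝ) : ℂ) := by
  apply Complex.ext
  · rw [Complex.add_re, Complex.ofReal_re, turn_re, turn_re, mul_neg, Real.cos_neg]; ring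
  · rw [Complex.add_im, Complex.ofReal_im, turn_im, turn_im, mul_neg, Real.sin_neg]; ring

/-- The Galois conjugates of an integral linear relation among the `λ_p`. -/
theorem sum_lam_conjugate (S : Finset ℕ) (c : ℕ → ℤ) (N : ℕ) (hN : N ≠ 0)
    (hS : ∀ p ∈ S, 2 * p ∣ N) (h0 : ∑ p ∈ S, (c p : ℝ) * lam p = 0) (a : ℕ)
    (ha : a.Coprime N) : ∑ p ∈ S, (c p : ℝ) * (turn (a / (2 * p))).re = 0 := by
  -- At the `N`-th root of unity `ζ ^ b`, the two monomials are complex conjugates with sum `2 cos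
  -- (2 π b / (2 p))`. Hence `Q` vanishes at `ζ`, and therefore at every `ζ ^ a` with the same
  -- minimal polynomial.
  set Q : Polynomial ℤ := ∑ p ∈ S, Polynomial.C (c p) *
    (Polynomial.X ^ (N / (2 * p)) + Polynomial.X ^ (N - N / (2 * p))) with hQ
  have hNR : (N : ℝ) ≠ 0 := by exact_mod_cast hN
  have key : ∀ b : ℕ, Polynomial.aeval (turn (1 / N) ^ b) Q =
      ((2 * ∑ p ∈ S, (c p : ℝ) * (turn (b / (2 * p))).re : ℝ) : ℂ) := by
    intro b
    rw [hQ, map_sum, Finset.mul_sum, Complex.ofReal_sum]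
    refine Finset.sum_congr rfl fun p hp => ?_
    obtain ⟨k, hk⟩ := hS p hp
    have hp0 : 0 < 2 * p := by
      rcases Nat.eq_zero_or_pos (2 * p) with h | h
      · rw [h] at hk; simp at hk; exact absurd hk hN
      · exact h
    have hpR : (p : ℝ) ≠ 0 := by
      have : p ≠ 0 := by omega
      exact_mod_cast this
    have hdiv : N / (2 * p) = k := by rw [hk]; exact Nat.mul_div_cancel_left k hp0
    have hkN : k ≤ N := by rw [hk]; exact Nat.le_mul_of_pos_left k hp0
    have hkR : (N : ℝ) = 2 * p * k := by rw [hk]; push_cast; ring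
    have hk0 : (k : ℝ) ≠ 0 := by
      intro h; rw [h] at hkR; simp at hkR; exact hN hkR
    rw [hdiv]
    simp only [map_mul, map_add, map_pow, Polynomial.aeval_X, Polynomial.aeval_C]
    rw [← turn_mul_nat, ← turn_mul_nat, ← turn_mul_nat]
    have e1 : (k : ℝ) * (b * (1 / N)) = b / (2 * p) := by
      rw [hkR]; field_simp
    have e2 : ((N - k : ℕ) : ℝ) * (b * (1 / N)) = b + -(b / (2 * p)) := by
      rw [Nat.cast_sub hkN, sub_mul, e1]; field_simp; ring
    rw [e1, e2, turn_add, turn_nat, one_mul, turn_add_turn_neg]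
    simp
    ring
  have hprim : IsPrimitiveRoot (turn (1 / N)) N := by
    have := Complex.isPrimitiveRoot_exp N hN
    convert this using 1
    unfold turn
    congr 1
    push_cast
    ring
  have h1 : Polynomial.aeval (turn (1 / N)) Q = 0 := by
    have := key 1
    rw [pow_one] at this
    rw [this]
    have h2 : (2 * ∑ p ∈ S, (c p : ℝ) * (turn ((1 : ℕ) / (2 * p))).re : ℝ) = 0 := by
      rw [← h0, Finset.mul_sum]
      refine Finset.sum_congr rfl fun p _ => ?_
      rw [lam_eq_turn]
      push_cast
      ring
    rw [h2]
    simp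
  have hdvd := minpoly.isIntegrallyClosed_dvd (hprim.isIntegral (Nat.pos_of_ne_zero hN)) h1
  rw [hprim.minpoly_eq_pow_coprime ha] at hdvd
  have h3 : Polynomial.aeval (turn (1 / N) ^ a) Q = 0 := by
    obtain ⟨g, hg⟩ := hdvd
    rw [hg, map_mul, minpoly.aeval, zero_mul]
  rw [key a] at h3
  have h4 : (2 * ∑ p ∈ S, (c p : ℝ) * (turn (a / (2 * p))).re : ℝ) = 0 := by exact_mod_cast h3
  linarith

/-- The alternating sum of conjugates that isolates the term with the largest index. -/
theorem re_turn_mul_prod_eq_zero (S R : Finset ℕ) (c : ℕ → ℤ) (N : ℕ) (hN : N ≠ 0)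
    (hS : ∀ p ∈ S, 2 * p ∣ N) (h0 : ∑ p ∈ S, (c p : ℝ) * lam p = 0) (m : ℕ → ℕ)
    (hm : ∀ T ⊆ R, (1 + ∑ r ∈ T, m r).Coprime N) (q : ℕ) (hq : q ∈ S) (hc : c q ≠ 0)
    (hkill : ∀ p ∈ S, p ≠ q → ∃ r ∈ R, 2 * p ∣ m r) :
    (turn (1 / (2 * q)) * ∏ r ∈ R, (1 - turn (m r / (2 * q)))).re = 0 := by
  have expand : ∀ p : ℕ, ∑ T ∈ R.powerset, (-1 : ℝ) ^ T.card *
      (turn (((1 + ∑ r ∈ T, m r : ℕ) : ℝ) / (2 * p))).re =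
      (turn (1 / (2 * p)) * ∏ r ∈ R, (1 - turn (m r / (2 * p)))).re := by
    intro p
    simp only [sub_eq_add_neg]
    rw [Finset.prod_one_add, Finset.mul_sum, Complex.re_sum]
    refine Finset.sum_congr rfl fun T _ => ?_
    rw [Finset.prod_neg]
    push_cast
    rw [add_div, turn_add, Finset.sum_div, turn_sum]
    rw [← Complex.re_ofReal_mul]
    congr 1
    push_cast
    ring
  have hsum : ∑ p ∈ S, (c p : ℝ) *
      (turn (1 / (2 * p)) * ∏ r ∈ R, (1 - turn (m r / (2 * p)))).re = 0 := by
    simp_rw [← expand, Finset.mul_sum]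
    rw [Finset.sum_comm]
    refine Finset.sum_eq_zero fun T hT => ?_
    have := sum_lam_conjugate S c N hN hS h0 _ (hm T (Finset.mem_powerset.1 hT))
    calc _ = (-1 : ℝ) ^ T.card * ∑ p ∈ S, (c p : ℝ) *
        (turn (((1 + ∑ r ∈ T, m r : ℕ) : ℝ) / (2 * p))).re := by
          rw [Finset.mul_sum]
          exact Finset.sum_congr rfl fun p _ => by ring
      _ = 0 := by rw [this, mul_zero]
  rw [Finset.sum_eq_single_of_mem q hq] at hsum
  · rcases mul_eq_zero.1 hsum with h | h
    · exact absurd (by exact_mod_cast h) hc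
    · exact h
  · intro p hp hpq
    obtain ⟨r, hr, k, hk⟩ := hkill p hp hpq
    have hp0 : (p : ℝ) ≠ 0 := by
      intro h
      have h' : p = 0 := by exact_mod_cast h
      have := hS p hp
      rw [h'] at this
      simp at this
      exact hN this
    have : turn ((m r : ℝ) / (2 * p)) = 1 := by
      rw [hk]
      have : ((2 * p * k : ℕ) : ℝ) / (2 * p) = k := by push_cast; field_simp
      rw [this, turn_nat]
    rw [Finset.prod_eq_zero hr (by rw [this, sub_self])]
    simp

/-- Two chords `1 - turn x` and `1 - turn y` are not real multiples of each other, unless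
`x - y` is an integer. -/
theorem eq_int_of_re_mul_one_sub_turn {w : ℂ} (hw : w ≠ 0) {x y : ℝ}
    (hx : (w * (1 - turn x)).re = 0) (hy : (w * (1 - turn y)).re = 0)
    (hx1 : turn x ≠ 1) (hy1 : turn y ≠ 1) : ∃ k : ℤ, x - y = k := by
  -- A chord from 1 is an imaginary multiple of the half-angle point, so the hypotheses make `w *
  -- turn (x / 2)` and `w * turn (y / 2)` real. Their quotient `turn ((x - y) / 2)` is then real as
  -- well.
  have half : ∀ z : ℝ, 1 - turn z =
      -2 * Complex.I * Real.sin (Real.pi * z) * turn (z / 2) := by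
    intro z
    have h2 : 2 * Real.pi * (z / 2) = Real.pi * z := by ring
    have hs2 : Real.sin (Real.pi * z) ^ 2 + Real.cos (Real.pi * z) ^ 2 = 1 :=
      Real.sin_sq_add_cos_sq _
    have h3 : turn z = turn (z / 2) ^ 2 := by
      rw [← turn_mul_nat]; congr 1; push_cast; ring
    have h4 : turn (z / 2) = ⟨Real.cos (Real.pi * z), Real.sin (Real.pi * z)⟩ := by
      apply Complex.ext
      · rw [turn_re, h2]
      · rw [turn_im, h2]
    rw [h3, h4]
    generalize Real.sin (Real.pi * z) = s at hs2 ⊢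
    generalize Real.cos (Real.pi * z) = c at hs2 ⊢
    apply Complex.ext
    · simp [pow_two]
      linarith
    · simp [pow_two]
      ring
  have im0 : ∀ z : ℝ, (w * (1 - turn z)).re = 0 → turn z ≠ 1 → (w * turn (z / 2)).im = 0 := by
    intro z hz hz1
    rw [half] at hz
    have hs : Real.sin (Real.pi * z) ≠ 0 := by
      intro h
      apply hz1
      have := half z
      rw [h] at this
      simp at this
      linear_combination -this
    have : w * (-2 * Complex.I * Real.sin (Real.pi * z) * turn (z / 2)) =
        ((Real.sin (Real.pi * z) : ℝ) : ℂ) * ((-2 * Complex.I) * (w * turn (z / 2))) := by ring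
    rw [this, Complex.re_ofReal_mul] at hz
    have h2 := (mul_eq_zero.1 hz).resolve_left hs
    have h3 : ((-2 * Complex.I) * (w * turn (z / 2))).re = 2 * (w * turn (z / 2)).im := by
      rw [Complex.mul_re]
      simp
    rw [h3] at h2
    linarith
  have hX := im0 x hx hx1
  have hY := im0 y hy hy1
  obtain ⟨s, hs⟩ : ∃ s : ℝ, w * turn (x / 2) = s := ⟨_, (Complex.conj_eq_iff_re.1
    (Complex.conj_eq_iff_im.2 hX)).symm⟩
  obtain ⟨t, ht⟩ : ∃ t : ℝ, w * turn (y / 2) = t := ⟨_, (Complex.conj_eq_iff_re.1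
    (Complex.conj_eq_iff_im.2 hY)).symm⟩
  have ht0 : t ≠ 0 := by
    intro h
    rw [h] at ht
    exact mul_ne_zero hw (turn_ne_zero _) (by simpa using ht)
  have hadd : turn (x / 2) = turn ((x - y) / 2) * turn (y / 2) := by
    rw [← turn_add]; congr 1; ring
  have h1 : turn ((x - y) / 2) * t = s := by
    rw [← ht, ← hs, hadd]; ring
  have h2 : (turn ((x - y) / 2)).im * t = 0 := by
    have := congrArg Complex.im h1
    simpa using this
  have h3 := (mul_eq_zero.1 h2).resolve_right ht0
  rw [turn_im] at h3
  obtain ⟨k, hk⟩ := Real.sin_eq_zero_iff.1 h3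
  refine ⟨k, ?_⟩
  have : Real.pi * (x - y) = Real.pi * k := by linarith
  exact mul_left_cancel₀ Real.pi_ne_zero this

/-- A toggle at the prime `r`: an integer divisible by the prime-to-`r` part of `N`. -/
def toggle (N r e : ℕ) : ℕ := N / r ^ N.factorization r * r ^ (e - 1)

/-- Away from `r` the toggle carries all of `N`; at `r` it carries `r ^ (e - 1)`, which suffices
once `r ^ e` fails to divide `a`. This is how a term of smaller index gets killed. -/
theorem dvd_toggle {N r e a : ℕ} (ha : a ≠ 0) (haN : a ∣ N) (hr : r.Prime)
    (h : ¬ r ^ e ∣ a) : a ∣ toggle N r e := by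
  have h1 : a.factorization r < e := by
    by_contra hlt
    exact h ((hr.pow_dvd_iff_le_factorization ha).2 (not_lt.1 hlt))
  rw [← Nat.ordProj_mul_ordCompl_eq_self a r, mul_comm, toggle]
  exact mul_dvd_mul (Nat.ordCompl_dvd_ordCompl_of_dvd haN r) (pow_dvd_pow r (by omega))

/-- When `e` is the exact exponent of `r` in `a`, the toggle misses divisibility by `a` by a single
factor `r`. The corresponding factor of the surviving term is thus `1 - ω` with `ω` an `r`-th root
of unity, nontrivial when `r` does not divide `k`. -/
theorem toggle_div {N r a : ℕ} (hN : N ≠ 0) (haN : a ∣ N) (hr : r.Prime) (hra : r ∣ a) :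
    ∃ g : ℕ, ¬ r ∣ g ∧ ∀ k : ℕ,
      ((toggle N r (a.factorization r) * k : ℕ) : ℝ) / a = (g * k : ℕ) / r := by
  have ha : a ≠ 0 := fun h => hN (by simpa [h] using haN)
  obtain ⟨g, hg⟩ := Nat.ordCompl_dvd_ordCompl_of_dvd haN r
  refine ⟨g, ?_, ?_⟩
  · intro h
    apply Nat.not_dvd_ordCompl hr hN
    rw [hg]
    exact h.mul_left _
  · intro k
    have he : 1 ≤ a.factorization r := (hr.dvd_iff_one_le_factorization ha).1 hra
    have h1 := Nat.ordProj_mul_ordCompl_eq_self a r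
    have hr0 : (r : ℝ) ≠ 0 := by exact_mod_cast hr.ne_zero
    have haR : (a : ℝ) ≠ 0 := by exact_mod_cast ha
    rw [div_eq_div_iff haR hr0, toggle, hg]
    norm_cast
    obtain ⟨e, he'⟩ := Nat.exists_eq_add_of_le he
    generalize hA : a / r ^ a.factorization r = A at *
    rw [he'] at h1 ⊢
    rw [← h1, Nat.add_sub_cancel_left, pow_add]
    ring

/-- Modulo a prime `l` dividing `N`, every toggle at another prime vanishes, so coprimality can be
tested one prime at a time. -/
theorem coprime_one_add_sum_toggle {N : ℕ} {R T : Finset ℕ} (hT : T ⊆ R)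
    (e k : ℕ → ℕ) (hR : ∀ r ∈ R, r.Prime)
    (hk : ∀ r ∈ R, ¬ r ∣ 1 + toggle N r (e r) * k r) :
    (1 + ∑ r ∈ T, toggle N r (e r) * k r).Coprime N := by
  refine Nat.coprime_of_dvd fun l hl hl1 hlN => ?_
  have hdvd : ∀ r ∈ T, r ≠ l → l ∣ toggle N r (e r) * k r := by
    intro r hr hrl
    have hrp := hR r (hT hr)
    have h1 := Nat.ordProj_mul_ordCompl_eq_self N r
    have h2 : l ∣ N / r ^ N.factorization r := by
      rw [← h1] at hlN
      refine (hl.dvd_mul.1 hlN).resolve_left fun h3 => hrl ?_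
      exact ((Nat.prime_dvd_prime_iff_eq hl hrp).1 (hl.dvd_of_dvd_pow h3)).symm
    exact (h2.mul_right _).mul_right _
  by_cases hlT : l ∈ T
  · rw [← Finset.add_sum_erase _ _ hlT, ← add_assoc] at hl1
    refine hk l (hT hlT) ((Nat.dvd_add_left ?_).1 hl1)
    exact Finset.dvd_sum fun r hr => hdvd r (Finset.mem_of_mem_erase hr) (Finset.ne_of_mem_erase hr)
  · have h3 : l ∣ ∑ r ∈ T, toggle N r (e r) * k r :=
      Finset.dvd_sum fun r hr => hdvd r hr fun h => hlT (h ▸ hr)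
    exact hl.one_lt.ne' (Nat.dvd_one.1 ((Nat.dvd_add_left h3).1 hl1))

/-- `k` is admissible for the toggle with factor `M` at the prime `r`. -/
def Admissible (M r k : ℕ) : Prop := ¬ r ∣ k ∧ ¬ r ∣ 1 + M * k

theorem admissible_of_dvd {M r k : ℕ} (hr : r.Prime) (hM : r ∣ M) (hk : ¬ r ∣ k) :
    Admissible M r k :=
  ⟨hk, fun h => hr.one_lt.ne' (Nat.dvd_one.1 ((Nat.dvd_add_left (hM.mul_right k)).1 h))⟩

/-- At most one residue class `k` modulo `r` solves `1 + M * k = 0`, so two incongruent nonzero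
residues cannot both be excluded. -/
theorem admissible_or {M r k d : ℕ} (hr : r.Prime) (hk : ¬ r ∣ k) (hkd : ¬ r ∣ k + d)
    (hd : ¬ r ∣ d) : Admissible M r k ∨ Admissible M r (k + d) := by
  by_contra hcon
  rw [not_or] at hcon
  have h1 : r ∣ 1 + M * k := by
    by_contra h; exact hcon.1 ⟨hk, h⟩
  have h2 : r ∣ 1 + M * (k + d) := by
    by_contra h; exact hcon.2 ⟨hkd, h⟩
  have h3 : r ∣ M * d := by
    have : 1 + M * (k + d) = (1 + M * k) + M * d := by ring
    rw [this] at h2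
    exact (Nat.dvd_add_right h1).1 h2
  have h4 : r ∣ M := (hr.dvd_mul.1 h3).resolve_right hd
  exact hr.one_lt.ne' (Nat.dvd_one.1 ((Nat.dvd_add_left (h4.mul_right k)).1 h1))

theorem exists_admissible_pair {M r : ℕ} (hr : r.Prime) (h : 5 ≤ r ∨ r = 3 ∧ 3 ∣ M) :
    ∃ k l, Admissible M r k ∧ Admissible M r l ∧ ¬ (r : ℤ) ∣ (k : ℤ) - l := by
  have nd : ∀ x, 0 < x → x < r → ¬ r ∣ x := fun x h0 hx => Nat.not_dvd_of_pos_of_lt h0 hx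
  have ndz : ∀ x y : ℕ, y < x → x - y < r → ¬ (r : ℤ) ∣ (x : ℤ) - y := by
    intro x y hxy hlt hd
    rw [← Nat.cast_sub hxy.le, Int.natCast_dvd_natCast] at hd
    exact nd _ (by omega) hlt hd
  rcases h with h | ⟨rfl, h⟩
  · have h12 := admissible_or (M := M) (k := 1) (d := 1) hr (nd _ (by omega) (by omega))
      (nd _ (by omega) (by omega)) (nd _ (by omega) (by omega))
    have h13 := admissible_or (M := M) (k := 1) (d := 2) hr (nd _ (by omega) (by omega))
      (nd _ (by omega) (by omega)) (nd _ (by omega) (by omega))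
    have h23 := admissible_or (M := M) (k := 2) (d := 1) hr (nd _ (by omega) (by omega))
      (nd _ (by omega) (by omega)) (nd _ (by omega) (by omega))
    by_cases h1 : Admissible M r 1
    · rcases h23 with h2 | h3
      · exact ⟨2, 1, h2, h1, ndz _ _ (by omega) (by omega)⟩
      · exact ⟨3, 1, h3, h1, ndz _ _ (by omega) (by omega)⟩
    · exact ⟨3, 2, h13.resolve_left h1, h12.resolve_left h1, ndz _ _ (by omega) (by omega)⟩
  · exact ⟨2, 1, admissible_of_dvd hr h (by norm_num), admissible_of_dvd hr h (by norm_num),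
      ndz _ _ (by omega) (by omega)⟩

theorem exists_admissible {M r : ℕ} (hr : r.Prime) (h : r = 2 → 2 ∣ M) :
    ∃ k, Admissible M r k := by
  rcases eq_or_ne r 2 with rfl | h2
  · exact ⟨1, admissible_of_dvd hr (h rfl) (by norm_num)⟩
  · have h3 : 3 ≤ r := by have := hr.two_le; omega
    have nd : ∀ x, 0 < x → x < r → ¬ r ∣ x := fun x h0 hx => Nat.not_dvd_of_pos_of_lt h0 hx
    rcases admissible_or (M := M) (k := 1) (d := 1) hr (nd _ (by omega) (by omega))
      (nd _ (by omega) (by omega)) (nd _ (by omega) (by omega)) with h | h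
    · exact ⟨_, h⟩
    · exact ⟨_, h⟩

theorem turn_half_odd {v : ℕ} (hv : ¬ 2 ∣ v) : turn (v / 2) = -1 := by
  obtain ⟨t, rfl⟩ : ∃ t, v = 2 * t + 1 := ⟨v / 2, by omega⟩
  have h : ((2 * t + 1 : ℕ) : ℝ) / 2 = t + 1 / 2 := by push_cast; ring
  rw [h, turn_add, turn_nat, one_mul]
  apply Complex.ext
  · rw [turn_re]
    have : 2 * Real.pi * (1 / 2) = Real.pi := by ring
    rw [this, Real.cos_pi]; simp
  · rw [turn_im]
    have : 2 * Real.pi * (1 / 2) = Real.pi := by ring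
    rw [this, Real.sin_pi]; simp

theorem turn_third {v : ℕ} (hv : ¬ 3 ∣ v) :
    (turn (v / 3)).re = -(1 / 2) ∧ (turn (v / 3)).im ^ 2 = 3 / 4 := by
  have hre : (turn (v / 3)).re = -(1 / 2) := by
    have h13 : 2 * Real.pi * (1 / 3) = Real.pi - Real.pi / 3 := by ring
    have h23 : 2 * Real.pi * (2 / 3) = Real.pi / 3 + Real.pi := by ring
    obtain ⟨t, ht⟩ : ∃ t, v = 3 * t + 1 ∨ v = 3 * t + 2 := ⟨v / 3, by omega⟩
    rcases ht with rfl | rfl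
    · have h : ((3 * t + 1 : ℕ) : ℝ) / 3 = t + 1 / 3 := by push_cast; ring
      rw [h, turn_add, turn_nat, one_mul, turn_re, h13, Real.cos_pi_sub, Real.cos_pi_div_three]
    · have h : ((3 * t + 2 : ℕ) : ℝ) / 3 = t + 2 / 3 := by push_cast; ring
      rw [h, turn_add, turn_nat, one_mul, turn_re, h23, Real.cos_add_pi, Real.cos_pi_div_three]
  refine ⟨hre, ?_⟩
  have h1 : (turn (v / 3)).im ^ 2 + (turn (v / 3)).re ^ 2 = 1 := by
    rw [turn_re, turn_im, Real.sin_sq_add_cos_sq]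
  rw [hre] at h1
  linarith

/-- The numbers `λ_p` with `p ≥ 3` are linearly independent over the integers. -/
theorem lam_coeff_eq_zero (S : Finset ℕ) (hS : ∀ p ∈ S, 3 ≤ p) (c : ℕ → ℤ)
    (h0 : ∑ p ∈ S, (c p : ℝ) * lam p = 0) : ∀ p ∈ S, c p = 0 := by
  by_contra hcon
  push Not at hcon
  obtain ⟨p₀, hp₀, hc₀⟩ := hcon
  have hne : (S.filter fun p => c p ≠ 0).Nonempty := ⟨p₀, Finset.mem_filter.2 ⟨hp₀, hc₀⟩⟩
  replace h0 : ∑ p ∈ S.filter fun p => c p ≠ 0, (c p : ℝ) * lam p = 0 := by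
    rw [← h0]
    refine Finset.sum_subset (Finset.filter_subset _ _) fun p hp hp' => ?_
    have : c p = 0 := by
      by_contra h; exact hp' (Finset.mem_filter.2 ⟨hp, h⟩)
    simp [this]
  have hS3 : ∀ p ∈ S.filter fun p => c p ≠ 0, 3 ≤ p := fun p hp => hS p (Finset.mem_filter.1 hp).1
  have hSc : ∀ p ∈ S.filter fun p => c p ≠ 0, c p ≠ 0 := fun p hp => (Finset.mem_filter.1 hp).2
  generalize S.filter (fun p => c p ≠ 0) = S' at *
  clear hp₀ hc₀ hS S
  rename' S' => S
  have hqS := S.max'_mem hne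
  have hmax : ∀ p ∈ S, p ≠ S.max' hne → p < S.max' hne := fun p hp hpq =>
    lt_of_le_of_ne (S.le_max' p hp) hpq
  generalize S.max' hne = q at *
  have hq3 := hS3 q hqS
  have hqR : (3 : ℝ) ≤ q := by exact_mod_cast hq3
  rcases hq3.eq_or_lt with rfl | hq4
  · have hS1 : S = {3} := by
      ext p
      rw [Finset.mem_singleton]
      constructor
      · intro hp
        by_contra h
        have := hmax p hp h
        have := hS3 p hp
        omega
      · rintro rfl; exact hqS
    rw [hS1, Finset.sum_singleton, lam] at h0
    have h1 : 2 * Real.cos (Real.pi / (3 : ℕ)) = 1 := by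
      push_cast; rw [Real.cos_pi_div_three]; norm_num
    rw [h1, mul_one] at h0
    exact hSc 3 hqS (by exact_mod_cast h0)
  obtain ⟨N, hN, hSN⟩ : ∃ N : ℕ, N ≠ 0 ∧ ∀ p ∈ S, 2 * p ∣ N := by
    refine ⟨∏ p ∈ S, 2 * p, ?_, fun p hp => Finset.dvd_prod_of_mem _ hp⟩
    exact Finset.prod_ne_zero_iff.2 fun p hp => by have := hS3 p hp; omega
  -- Take `f = 2 * q` for even `q` and `f = q` for odd `q`. For odd `q` the prime 2 must be left
  -- out: its toggle would be odd, so `1 + M * k` would be even for every odd `k`.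
  obtain ⟨f, hf0, hfq, hfmin, hf2, hfodd⟩ : ∃ f : ℕ, f ≠ 0 ∧ f ∣ 2 * q ∧
      (∀ p, p ≠ 0 → p < q → ¬ f ∣ 2 * p) ∧ (2 ∣ f → 2 ∣ q) ∧ (¬ 2 ∣ f → f = q) := by
    rcases Nat.even_or_odd' q with ⟨b, hb | hb⟩
    · exact ⟨2 * q, by omega, dvd_rfl, fun p hp hpq h => by
        have := Nat.le_of_dvd (by omega) h; omega, fun _ => ⟨b, hb⟩, fun h => absurd ⟨q, rfl⟩ h⟩
    · refine ⟨q, by omega, dvd_mul_left _ _, ?_, fun h => h, fun _ => rfl⟩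
      rintro p hp hpq ⟨z, hz⟩
      have hz2 : z < 2 := by
        by_contra h
        have : q * 2 ≤ q * z := Nat.mul_le_mul_left q (by omega)
        omega
      interval_cases z <;> omega
  have h2q : 2 * q ≠ 0 := by omega
  set R := f.primeFactors with hR
  set e : ℕ → ℕ := fun r => (2 * q).factorization r with he
  have hRp : ∀ r ∈ R, r.Prime := fun r hr => Nat.prime_of_mem_primeFactors hr
  have hRf : ∀ r ∈ R, r ∣ f := fun r hr => Nat.dvd_of_mem_primeFactors hr
  have hR2 : ∀ r ∈ R, r ∣ 2 * q := fun r hr => (hRf r hr).trans hfq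
  have hMdvd : ∀ r, r.Prime → r ^ 2 ∣ 2 * q → r ∣ toggle N r (e r) := by
    intro r hr h
    have h1 : 2 ≤ e r := (hr.pow_dvd_iff_le_factorization h2q).1 h
    exact (dvd_pow_self r (by omega)).mul_left _
  -- Otherwise `2 * p` would contain the full power of each prime of `f`, making `f` a divisor of `2
  -- * p` despite `p < q`.
  have hkillR : ∀ p ∈ S, p ≠ q → ∃ r ∈ R, 2 * p ∣ toggle N r (e r) := by
    intro p hp hpq
    have hp3 := hS3 p hp
    by_contra hcon
    push Not at hcon
    refine hfmin p (by omega) (hmax p hp hpq) ?_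
    rw [← Nat.factorization_prime_le_iff_dvd hf0 (by omega)]
    intro r hr
    by_cases hrR : r ∈ R
    · have h1 : r ^ e r ∣ 2 * p := by
        by_contra h
        exact hcon r hrR (dvd_toggle (by omega) (hSN p hp) hr h)
      exact ((Nat.factorization_le_iff_dvd hf0 h2q).2 hfq r).trans
        ((hr.pow_dvd_iff_le_factorization (by omega)).1 h1)
    · have : f.factorization r = 0 := by
        rw [← Finsupp.notMem_support_iff, Nat.support_factorization]; exact hrR
      omega
  have hgex : ∀ r, ∃ g : ℕ, r ∈ R → ¬ r ∣ g ∧ ∀ k : ℕ,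
      ((toggle N r (e r) * k : ℕ) : ℝ) / (2 * q) = (g * k : ℕ) / r := by
    intro r
    by_cases hr : r ∈ R
    · obtain ⟨g, h1, h2⟩ := toggle_div hN (hSN q hqS) (hRp r hr) (hR2 r hr)
      exact ⟨g, fun _ => ⟨h1, fun k => by rw [← h2 k]; push_cast; rfl⟩⟩
    · exact ⟨0, fun h => absurd h hr⟩
  choose g hg using hgex
  have hmain : ∀ k : ℕ → ℕ, (∀ r ∈ R, Admissible (toggle N r (e r)) r (k r)) →
      (turn (1 / (2 * q)) * ∏ r ∈ R, (1 - turn ((g r * k r : ℕ) / r))).re = 0 := by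
    intro k hk
    have := re_turn_mul_prod_eq_zero S R c N hN hSN h0 (fun r => toggle N r (e r) * k r)
      (fun T hT => coprime_one_add_sum_toggle hT e k hRp fun r hr => (hk r hr).2) q hqS
      (hSc q hqS) (fun p hp hpq => by
        obtain ⟨r, hr, h⟩ := hkillR p hp hpq
        exact ⟨r, hr, h.mul_right _⟩)
    rw [← this]
    congr 2
    exact Finset.prod_congr rfl fun r hr => by rw [(hg r hr).2]
  have hturn : ∀ r ∈ R, ∀ k, ¬ r ∣ k → turn ((g r * k : ℕ) / r) ≠ 1 := by
    intro r hr k hk h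
    obtain ⟨z, hz⟩ := (turn_eq_one_iff _).1 h
    have hr0 : (r : ℝ) ≠ 0 := by exact_mod_cast (hRp r hr).ne_zero
    rw [div_eq_iff hr0] at hz
    have hz' : ((g r * k : ℕ) : ℤ) = z * r := by exact_mod_cast hz
    have : r ∣ g r * k := by
      rw [← Int.natCast_dvd_natCast, hz']
      exact dvd_mul_left _ _
    exact ((hRp r hr).dvd_mul.1 this).elim (hg r hr).1 hk
  have hkex : ∀ r, ∃ k, r ∈ R → Admissible (toggle N r (e r)) r k := by
    intro r
    by_cases hr : r ∈ R
    · obtain ⟨k, hk⟩ := exists_admissible (M := toggle N r (e r)) (hRp r hr) (by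
        rintro rfl
        refine hMdvd 2 Nat.prime_two ?_
        rw [pow_two]
        exact mul_dvd_mul_left 2 (hf2 (hRf 2 hr)))
      exact ⟨k, fun _ => hk⟩
    · exact ⟨0, fun h => absurd h hr⟩
  choose k₀ hk₀ using hkex
  -- If some prime admits two incongruent multipliers, changing only that multiplier yields two
  -- different chords with the same direction, which is impossible.
  by_cases hpair : ∃ r ∈ R, 5 ≤ r ∨ r = 3 ∧ 3 ∣ toggle N r (e r)
  · obtain ⟨r, hr, hr5⟩ := hpair
    obtain ⟨k, l, hk, hl, hkl⟩ := exists_admissible_pair (hRp r hr) hr5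
    set w := turn (1 / (2 * q)) * ∏ s ∈ R.erase r, (1 - turn ((g s * k₀ s : ℕ) / s)) with hw
    have hw0 : w ≠ 0 := by
      refine mul_ne_zero (turn_ne_zero _) (Finset.prod_ne_zero_iff.2 fun s hs h => ?_)
      have hsR := Finset.mem_of_mem_erase hs
      exact hturn s hsR (k₀ s) (hk₀ s hsR).1 (sub_eq_zero.1 h).symm
    have hstep : ∀ b, Admissible (toggle N r (e r)) r b →
        (w * (1 - turn ((g r * b : ℕ) / r))).re = 0 := by
      intro b hb
      have := hmain (Function.update k₀ r b) (by
        intro s hs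
        by_cases hsr : s = r
        · subst hsr; rwa [Function.update_self]
        · rw [Function.update_of_ne hsr]; exact hk₀ s hs)
      rw [← Finset.mul_prod_erase _ _ hr, Function.update_self] at this
      rw [← this, hw]
      congr 1
      rw [mul_assoc]
      congr 1
      rw [mul_comm]
      congr 1
      exact Finset.prod_congr rfl fun s hs => by
        rw [Function.update_of_ne (Finset.ne_of_mem_erase hs)]
    obtain ⟨z, hz⟩ := eq_int_of_re_mul_one_sub_turn hw0 (hstep k hk) (hstep l hl)
      (hturn r hr k hk.1) (hturn r hr l hl.1)
    have hr0 : (r : ℝ) ≠ 0 := by exact_mod_cast (hRp r hr).ne_zero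
    rw [← sub_div, div_eq_iff hr0] at hz
    have hz' : (g r : ℤ) * ((k : ℤ) - l) = z * r := by
      have : (g r : ℝ) * ((k : ℝ) - l) = z * r := by rw [← hz]; push_cast; ring
      exact_mod_cast this
    have hdv : (r : ℤ) ∣ (g r : ℤ) * ((k : ℤ) - l) := hz' ▸ dvd_mul_left _ _
    rcases (Nat.prime_iff_prime_int.1 (hRp r hr)).dvd_or_dvd hdv with h | h
    · exact (hg r hr).1 (Int.natCast_dvd_natCast.1 h)
    · exact hkl h
  · push Not at hpair
    have hR23 : ∀ r ∈ R, r = 2 ∨ r = 3 := by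
      intro r hr
      have h1 := (hpair r hr).1
      have h2 := (hRp r hr).two_le
      have h3 : r ≠ 4 := by rintro rfl; exact absurd (hRp 4 hr) (by norm_num)
      omega
    -- Without 2, the number `f = q ≥ 4` would be a power of 3, hence divisible by 9; the toggle at
    -- 3 would then be divisible by 3, the case already excluded.
    have h2R : 2 ∈ R := by
      by_contra h
      have h2f : ¬ 2 ∣ f := fun hd => h (Nat.mem_primeFactors.2 ⟨Nat.prime_two, hd, hf0⟩)
      have hfq' := hfodd h2f
      have hpow := Nat.eq_prime_pow_of_unique_prime_dvd (n := f) (p := 3) hf0 (by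
        intro d hd hdf
        have hdR : d ∈ R := Nat.mem_primeFactors.2 ⟨hd, hdf, hf0⟩
        exact (hR23 d hdR).resolve_left fun h' => h (h' ▸ hdR))
      have hlen : 2 ≤ f.primeFactorsList.length := by
        by_contra hlt
        have : f.primeFactorsList.length ≤ 1 := by omega
        have := Nat.pow_le_pow_right (n := 3) (by norm_num) this
        omega
      have h9 : 3 ^ 2 ∣ f := by rw [hpow]; exact pow_dvd_pow 3 hlen
      have h3R : 3 ∈ R := Nat.mem_primeFactors.2
        ⟨Nat.prime_three, (dvd_pow_self 3 (by norm_num)).trans h9, hf0⟩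
      exact (hpair 3 h3R).2 rfl (hMdvd 3 Nat.prime_three (h9.trans hfq))
    have hkey := hmain k₀ hk₀
    have h2odd : ¬ 2 ∣ g 2 * k₀ 2 := by
      intro h
      exact (Nat.prime_two.dvd_mul.1 h).elim (hg 2 h2R).1 (hk₀ 2 h2R).1
    have hangle : 2 * Real.pi * (1 / (2 * q)) = Real.pi / q := by field_simp
    have hq4R : (4 : ℝ) ≤ q := by exact_mod_cast hq4
    have hle : Real.pi / q ≤ Real.pi / 4 := by
      have := Real.pi_pos
      gcongr
    have hpos : 0 < Real.pi / q := by have := Real.pi_pos; positivity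
    have hcos : Real.cos (Real.pi / 4) ≤ Real.cos (Real.pi / q) :=
      Real.cos_le_cos_of_nonneg_of_le_pi hpos.le (by have := Real.pi_pos; linarith) hle
    have hsin : Real.sin (Real.pi / q) ≤ Real.sin (Real.pi / 4) :=
      Real.sin_le_sin_of_le_of_le_pi_div_two (by have := Real.pi_pos; linarith)
        (by have := Real.pi_pos; linarith) hle
    have hsin0 : 0 < Real.sin (Real.pi / q) :=
      Real.sin_pos_of_pos_of_lt_pi hpos (by have := Real.pi_pos; linarith)
    rw [Real.cos_pi_div_four] at hcos
    rw [Real.sin_pi_div_four] at hsin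
    rw [← Finset.mul_prod_erase _ _ h2R] at hkey
    have hcast2 : ((2 : ℕ) : ℝ) = 2 := by norm_num
    have hcast3 : ((3 : ℕ) : ℝ) = 3 := by norm_num
    rw [hcast2, turn_half_odd h2odd] at hkey
    by_cases h3R : 3 ∈ R
    · have hR1 : R.erase 2 = {3} := by
        ext r
        rw [Finset.mem_erase, Finset.mem_singleton]
        constructor
        · rintro ⟨h1, h2⟩; exact (hR23 r h2).resolve_left h1
        · rintro rfl; exact ⟨by norm_num, h3R⟩
      have h3n : ¬ 3 ∣ g 3 * k₀ 3 := by
        intro h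
        exact (Nat.prime_three.dvd_mul.1 h).elim (hg 3 h3R).1 (hk₀ 3 h3R).1
      obtain ⟨hre, him⟩ := turn_third h3n
      rw [hR1, Finset.prod_singleton, hcast3] at hkey
      have h1 : (1 - (-1 : ℂ)) = ((2 : ℝ) : ℂ) := by push_cast; norm_num
      rw [h1, mul_left_comm, Complex.re_ofReal_mul, Complex.mul_re, Complex.sub_re, Complex.sub_im,
        hre, turn_re, turn_im, hangle] at hkey
      simp only [Complex.one_re, Complex.one_im] at hkey
      generalize (turn (((g 3 * k₀ 3 : ℕ) : ℝ) / 3)).im = y at *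
      generalize Real.cos (Real.pi / q) = C at *
      generalize Real.sin (Real.pi / q) = s at *
      have hsc : s ≤ C := hsin.trans hcos
      -- The vanishing real part would force `|tan (π / q)| = √3`, whereas `q ≥ 4` gives `tan (π /
      -- q) ≤ 1`.
      have h2 : 3 / 2 * C = -(s * y) := by linarith
      have h3 : (3 / 2 * C) ^ 2 = s ^ 2 * (3 / 4) := by rw [h2, ← him]; ring
      nlinarith
    · have hR1 : R.erase 2 = ∅ := by
        ext r
        simp only [Finset.mem_erase, Finset.notMem_empty, iff_false, not_and]
        intro h1 h2
        rcases hR23 r h2 with h | h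
        · exact h1 h
        · exact h3R (h ▸ h2)
      rw [hR1, Finset.prod_empty, mul_one] at hkey
      have h1 : (1 - (-1 : ℂ)) = ((2 : ℝ) : ℂ) := by push_cast; norm_num
      rw [h1, mul_comm, Complex.re_ofReal_mul, turn_re, hangle] at hkey
      linarith

/-- A multiset of integers `≥ 3` is determined by the sum of the corresponding `λ_p`. -/
theorem lamSum_injOn {A B : Multiset ℕ} (hA : ∀ p ∈ A, 3 ≤ p) (hB : ∀ p ∈ B, 3 ≤ p)
    (h : lamSum A = lamSum B) : A = B := by
  have key : ∀ C : Multiset ℕ, C.toFinset ⊆ A.toFinset ∪ B.toFinset →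
      lamSum C = ∑ p ∈ A.toFinset ∪ B.toFinset, (C.count p : ℝ) * lam p := by
    intro C hC
    rw [lamSum, Finset.sum_multiset_map_count]
    simp only [nsmul_eq_mul]
    refine Finset.sum_subset hC fun p _ hp => ?_
    rw [Multiset.count_eq_zero.2 fun h => hp (Multiset.mem_toFinset.2 h)]
    simp
  have hz := lam_coeff_eq_zero (A.toFinset ∪ B.toFinset) (by
    intro p hp
    rcases Finset.mem_union.1 hp with h | h
    · exact hA p (Multiset.mem_toFinset.1 h)
    · exact hB p (Multiset.mem_toFinset.1 h)) (fun p => (A.count p : ℤ) - B.count p) (by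
    have h1 := key A Finset.subset_union_left
    have h2 := key B Finset.subset_union_right
    rw [h, h2] at h1
    rw [← sub_eq_zero, ← Finset.sum_sub_distrib] at h1
    rw [← neg_eq_zero, ← h1, ← Finset.sum_neg_distrib]
    refine Finset.sum_congr rfl fun p _ => ?_
    push_cast
    ring)
  ext p
  by_cases hp : p ∈ A.toFinset ∪ B.toFinset
  · have := hz p hp
    omega
  · rw [Finset.mem_union, not_or, Multiset.mem_toFinset, Multiset.mem_toFinset] at hp
    rw [Multiset.count_eq_zero.2 hp.1, Multiset.count_eq_zero.2 hp.2]

/-! ### Subgons of non-crossing edge relations -/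

section Subgons

variable {V : Type*} [LinearOrder V] {E : V → V → Prop} {P Q : Finset V}

/-- No two edges cross. -/
def NonCrossing (E : V → V → Prop) : Prop :=
  ∀ a b c d, a < c → c < b → b < d → E a b → ¬ E c d

/-- Cyclically consecutive elements of `X` are joined. -/
def IsClosedPolygon (E : V → V → Prop) (X : Finset V) : Prop :=
  3 ≤ X.card ∧ ∀ x ∈ X, ∀ y ∈ X, x < y → CyclicNeighbors X x y → E x y

theorem card_le_two_of_forall {x y : V} (h : ∀ z ∈ P, x ≤ z ∧ z ≤ y)
    (h' : ∀ z ∈ P, ¬ (x < z ∧ z < y)) : P.card ≤ 2 := by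
  have : P ⊆ {x, y} := by
    intro z hz
    have h1 := h z hz
    have h2 := h' z hz
    rw [Finset.mem_insert, Finset.mem_singleton]
    rcases h1.1.eq_or_lt with h3 | h3
    · exact Or.inl h3.symm
    · rcases h1.2.eq_or_lt with h4 | h4
      · exact Or.inr h4
      · exact absurd ⟨h3, h4⟩ h2
  exact (Finset.card_le_card this).trans Finset.card_le_two

/-- An edge does not separate two vertices of a subgon. -/
theorem IsSubgon.not_separated (hE : NonCrossing E) (hQ : IsSubgon E Q) {x y z z' : V}
    (hxy : E x y) (hz : z ∈ Q) (hxz : x < z) (hzy : z < y) (hz' : z' ∈ Q)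
    (hout : z' < x ∨ y < z') : False := by
  have hne : Q.Nonempty := ⟨z, hz⟩
  have hIn : (Q.filter fun a => x < a ∧ a < y).Nonempty :=
    ⟨z, Finset.mem_filter.2 ⟨hz, hxz, hzy⟩⟩
  obtain ⟨z₁, hz₁, hmin⟩ := Finset.exists_min_image _ id hIn
  obtain ⟨z₂, hz₂, hmax⟩ := Finset.exists_max_image _ id hIn
  simp only [Finset.mem_filter, id] at hz₁ hz₂ hmin hmax
  -- The edge of `Q` entering its first vertex `z₁` inside the interval comes from outside, so it
  -- crosses `x y` unless it starts at `x`. If `z₁` is the minimum of `Q`, that edge comes from the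
  -- maximum of `Q` beyond `y` and does cross. The argument for `y` is symmetric.
  have hxQ : x ∈ Q := by
    by_cases hlow : (Q.filter fun a => a < z₁).Nonempty
    · obtain ⟨z₀, hz₀, hmax₀⟩ := Finset.exists_max_image _ id hlow
      simp only [Finset.mem_filter, id] at hz₀ hmax₀
      have h1 : z₀ ≤ x := by
        by_contra h
        exact absurd (hmin z₀ ⟨hz₀.1, not_le.1 h, hz₀.2.trans hz₁.2.2⟩) (not_le.2 hz₀.2)
      have h2 : E z₀ z₁ := (hQ.2 z₀ hz₀.1 z₁ hz₁.1 hz₀.2).2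
        (Or.inl fun a ha hlt => absurd (hmax₀ a ⟨ha, hlt.2⟩) (not_le.2 hlt.1))
      rcases h1.eq_or_lt with h3 | h3
      · exact h3 ▸ hz₀.1
      · exact absurd hxy (hE z₀ z₁ x y h3 hz₁.2.1 hz₁.2.2 h2)
    · have hall : ∀ a ∈ Q, z₁ ≤ a := fun a ha => by
        by_contra h
        exact hlow ⟨a, Finset.mem_filter.2 ⟨ha, not_le.1 h⟩⟩
      have hyz' : y < z' := hout.resolve_left fun h =>
        absurd (hall z' hz') (not_le.2 (h.trans hz₁.2.1))
      have h1 : y < Q.max' hne := hyz'.trans_le (Q.le_max' z' hz')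
      have h2 : E z₁ (Q.max' hne) := (hQ.2 z₁ hz₁.1 _ (Q.max'_mem hne) (hz₁.2.2.trans h1)).2
        (Or.inr fun a ha => ⟨hall a ha, Q.le_max' a ha⟩)
      exact absurd h2 (hE x y z₁ _ hz₁.2.1 hz₁.2.2 h1 hxy)
  have hyQ : y ∈ Q := by
    by_cases hhigh : (Q.filter fun a => z₂ < a).Nonempty
    · obtain ⟨z₃, hz₃, hmin₃⟩ := Finset.exists_min_image _ id hhigh
      simp only [Finset.mem_filter, id] at hz₃ hmin₃
      have h1 : y ≤ z₃ := by
        by_contra h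
        exact absurd (hmax z₃ ⟨hz₃.1, hz₂.2.1.trans hz₃.2, not_le.1 h⟩) (not_le.2 hz₃.2)
      have h2 : E z₂ z₃ := (hQ.2 z₂ hz₂.1 z₃ hz₃.1 hz₃.2).2
        (Or.inl fun a ha hlt => absurd (hmin₃ a ⟨ha, hlt.1⟩) (not_le.2 hlt.2))
      rcases h1.eq_or_lt with h3 | h3
      · exact h3 ▸ hz₃.1
      · exact absurd h2 (hE x y z₂ z₃ hz₂.2.1 hz₂.2.2 h3 hxy)
    · have hall : ∀ a ∈ Q, a ≤ z₂ := fun a ha => by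
        by_contra h
        exact hhigh ⟨a, Finset.mem_filter.2 ⟨ha, not_le.1 h⟩⟩
      have hz'x : z' < x := hout.resolve_right fun h =>
        absurd (hall z' hz') (not_le.2 (hz₂.2.2.trans h))
      have h1 : Q.min' hne < x := (Q.min'_le z' hz').trans_lt hz'x
      have h2 : E (Q.min' hne) z₂ := (hQ.2 _ (Q.min'_mem hne) z₂ hz₂.1 (h1.trans hz₂.2.1)).2
        (Or.inr fun a ha => ⟨Q.min'_le a ha, hall a ha⟩)
      exact absurd hxy (hE _ z₂ x y h1 hz₂.2.1 hz₂.2.2 h2)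
  rcases (hQ.2 x hxQ y hyQ (hxz.trans hzy)).1 hxy with h | h
  · exact h z hz ⟨hxz, hzy⟩
  · have := h z' hz'
    rcases hout with h1 | h1
    · exact absurd this.1 (not_le.2 h1)
    · exact absurd this.2 (not_le.2 h1)

/-- Two different subgons lie on different sides of an edge of the first one. -/
theorem IsSubgon.exists_separating (hE : NonCrossing E) (hP : IsSubgon E P) (hQ : IsSubgon E Q)
    (h : ¬ Q ⊆ P) : ∃ x ∈ P, ∃ y ∈ P, x < y ∧
      ((∀ z ∈ P, ¬ (x < z ∧ z < y)) ∧ (∀ z ∈ Q, x ≤ z ∧ z ≤ y) ∨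
       (∀ z ∈ P, x ≤ z ∧ z ≤ y) ∧ ∀ z ∈ Q, ¬ (x < z ∧ z < y)) := by
  rw [Finset.not_subset] at h
  obtain ⟨z, hzQ, hzP⟩ := h
  have hne : P.Nonempty := Finset.card_pos.1 (by have := hP.1; omega)
  have hmM : P.min' hne < P.max' hne := Finset.min'_lt_max'_of_card P (by have := hP.1; omega)
  by_cases hin : P.min' hne < z ∧ z < P.max' hne
  · obtain ⟨x, hx, hxmax⟩ := Finset.exists_max_image (P.filter fun a => a < z) id
      ⟨_, Finset.mem_filter.2 ⟨P.min'_mem hne, hin.1⟩⟩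
    obtain ⟨y, hy, hymin⟩ := Finset.exists_min_image (P.filter fun a => z < a) id
      ⟨_, Finset.mem_filter.2 ⟨P.max'_mem hne, hin.2⟩⟩
    simp only [Finset.mem_filter, id] at hx hy hxmax hymin
    have hxy := hx.2.trans hy.2
    have hno : ∀ a ∈ P, ¬ (x < a ∧ a < y) := by
      rintro a ha ⟨h1, h2⟩
      rcases lt_trichotomy a z with h3 | h3 | h3
      · exact absurd (hxmax a ⟨ha, h3⟩) (not_le.2 h1)
      · exact hzP (h3 ▸ ha)
      · exact absurd (hymin a ⟨ha, h3⟩) (not_le.2 h2)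
    have hEd : E x y := (hP.2 x hx.1 y hy.1 hxy).2 (Or.inl hno)
    refine ⟨x, hx.1, y, hy.1, hxy, Or.inl ⟨hno, fun a ha => ?_⟩⟩
    by_contra hcon
    refine hQ.not_separated hE hEd hzQ hx.2 hy.2 ha ?_
    rw [not_and_or, not_le, not_le] at hcon
    exact hcon
  · have hall : ∀ a ∈ P, P.min' hne ≤ a ∧ a ≤ P.max' hne := fun a ha =>
      ⟨P.min'_le a ha, P.le_max' a ha⟩
    have hEd : E (P.min' hne) (P.max' hne) :=
      (hP.2 _ (P.min'_mem hne) _ (P.max'_mem hne) hmM).2 (Or.inr hall)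
    refine ⟨_, P.min'_mem hne, _, P.max'_mem hne, hmM, Or.inr ⟨hall, ?_⟩⟩
    rintro a ha ⟨h1, h2⟩
    refine hQ.not_separated hE hEd ha h1 h2 hzQ ?_
    rw [not_and_or, not_lt, not_lt] at hin
    rcases hin with h3 | h3
    · exact Or.inl (lt_of_le_of_ne h3 fun h4 => hzP (h4 ▸ P.min'_mem hne))
    · exact Or.inr (lt_of_le_of_ne h3 fun h4 => hzP (h4 ▸ P.max'_mem hne))

/-- Otherwise an edge of `P` would have `P` on one side and `Q` on the other; as `P ⊆ Q`, only the
two endpoints of the edge would remain in `P`. -/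
theorem IsSubgon.eq_of_subset (hE : NonCrossing E) (hP : IsSubgon E P) (hQ : IsSubgon E Q)
    (h : P ⊆ Q) : P = Q := by
  refine h.antisymm ?_
  by_contra hcon
  obtain ⟨x, -, y, -, -, h1 | h1⟩ := hP.exists_separating hE hQ hcon
  · have := card_le_two_of_forall (fun z hz => h1.2 z (h hz)) h1.1
    have := hP.1
    omega
  · have := card_le_two_of_forall h1.1 (fun z hz => h1.2 z (h hz))
    have := hP.1
    omega

/-- A subgon is determined by its first and last vertex. -/
theorem IsSubgon.eq_of_extremes (hE : NonCrossing E) (hP : IsSubgon E P) (hQ : IsSubgon E Q)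
    {a b : V} (haP : a ∈ P) (hbP : b ∈ P) (haQ : a ∈ Q) (hbQ : b ∈ Q)
    (hPab : ∀ z ∈ P, a ≤ z ∧ z ≤ b) (hQab : ∀ z ∈ Q, a ≤ z ∧ z ≤ b) : P = Q := by
  refine (hQ.eq_of_subset hE hP ?_).symm
  by_contra hcon
  obtain ⟨x, hx, y, hy, hxy, h | h⟩ := hP.exists_separating hE hQ hcon
  · have h1 : x = a := le_antisymm (h.2 a haQ).1 (hPab x hx).1
    have h2 : y = b := le_antisymm (hPab y hy).2 (h.2 b hbQ).2
    subst h1 h2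
    have := card_le_two_of_forall hPab h.1
    have := hP.1
    omega
  · have h1 : x = a := le_antisymm (h.1 a haP).1 (hPab x hx).1
    have h2 : y = b := le_antisymm (hPab y hy).2 (h.1 b hbP).2
    subst h1 h2
    have := card_le_two_of_forall hQab h.2
    have := hQ.1
    omega

theorem not_all_between_of_covBy {u w : V} (huw : u ⋖ w) (hP : IsSubgon E P)
    (h : ∀ z ∈ P, u ≤ z ∧ z ≤ w) : False := by
  have := card_le_two_of_forall h fun z _ hz => huw.2 hz.1 hz.2
  have := hP.1
  omega

/-- At most one subgon is incident to a boundary edge. -/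
theorem IsSubgon.eq_of_covBy (hE : NonCrossing E) (hP : IsSubgon E P) (hQ : IsSubgon E Q)
    {u w : V} (huw : u ⋖ w) (huP : u ∈ P) (hwP : w ∈ P) (huQ : u ∈ Q) (hwQ : w ∈ Q) : P = Q := by
  refine (hQ.eq_of_subset hE hP ?_).symm
  by_contra hcon
  have key : ∀ x y : V, (x ≤ u ∧ u ≤ y) → (x ≤ w ∧ w ≤ y) → ¬ (x < u ∧ u < y) →
      ¬ (x < w ∧ w < y) → x = u ∧ y = w := by
    intro x y h1 h2 h3 h4
    have hlt := huw.1
    constructor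
    · exact le_antisymm h1.1 (not_lt.1 fun h => h3 ⟨h, hlt.trans_le h2.2⟩)
    · exact le_antisymm (not_lt.1 fun h => h4 ⟨h1.1.trans_lt hlt, h⟩) h2.2
  obtain ⟨x, hx, y, hy, hxy, h | h⟩ := hP.exists_separating hE hQ hcon
  · obtain ⟨rfl, rfl⟩ := key x y (h.2 u huQ) (h.2 w hwQ) (h.1 u huP) (h.1 w hwP)
    exact not_all_between_of_covBy huw hQ h.2
  · obtain ⟨rfl, rfl⟩ := key x y (h.1 u huP) (h.1 w hwP) (h.2 u huQ) (h.2 w hwQ)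
    exact not_all_between_of_covBy huw hP h.1

/-- If a subgon contains both boundary edges at `u`, it is the only subgon at `u`. -/
theorem IsSubgon.eq_of_both_edges (hE : NonCrossing E) (hP : IsSubgon E P) (hQ : IsSubgon E Q)
    {t u w : V} (htu : t ⋖ u) (huw : u ⋖ w) (htP : t ∈ P) (huP : u ∈ P) (hwP : w ∈ P)
    (huQ : u ∈ Q) : Q = P := by
  refine hQ.eq_of_subset hE hP ?_
  by_contra hcon
  obtain ⟨x, hx, y, hy, hxy, h | h⟩ := hP.exists_separating hE hQ hcon
  · have hu := h.2 u huQ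
    rcases hu.1.eq_or_lt with h1 | h1
    · subst h1
      have h2 : y ≤ w := not_lt.1 fun hlt => h.1 w hwP ⟨huw.1, hlt⟩
      exact not_all_between_of_covBy huw hQ fun z hz => ⟨(h.2 z hz).1, (h.2 z hz).2.trans h2⟩
    · rcases hu.2.eq_or_lt with h3 | h3
      · subst h3
        have h2 : t ≤ x := not_lt.1 fun hlt => h.1 t htP ⟨hlt, htu.1⟩
        exact not_all_between_of_covBy htu hQ fun z hz => ⟨h2.trans (h.2 z hz).1, (h.2 z hz).2⟩
      · exact h.1 u huP ⟨h1, h3⟩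
  · exact h.2 u huQ ⟨(h.1 t htP).1.trans_lt htu.1, huw.1.trans_le (h.1 w hwP).2⟩

/-- Every boundary edge of a closed polygon is incident to a subgon. -/
theorem exists_isSubgon_of_covBy {u w : V} (huw : u ⋖ w) {X : Finset V}
    (hX : IsClosedPolygon E X) (hu : u ∈ X) (hw : w ∈ X) :
    ∃ P, IsSubgon E P ∧ u ∈ P ∧ w ∈ P := by
  induction hN : X.card using Nat.strong_induction_on generalizing X with
  | _ N ih =>
    by_cases hsub : IsSubgon E X
    · exact ⟨X, hsub, hu, hw⟩
    have hex : ∃ x ∈ X, ∃ y ∈ X, x < y ∧ E x y ∧ ¬ CyclicNeighbors X x y := by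
      by_contra hcon
      push Not at hcon
      exact hsub ⟨hX.1, fun x hx y hy hxy => ⟨hcon x hx y hy hxy, hX.2 x hx y hy hxy⟩⟩
    -- Cut `X` along the chord `x y`. Since `u ⋖ w`, both endpoints lie on a common side, which is a
    -- smaller closed polygon because `z` or `z'` is removed.
    obtain ⟨x, hx, y, hy, hxy, hExy, hnb⟩ := hex
    unfold CyclicNeighbors at hnb
    rw [not_or] at hnb
    obtain ⟨hn1, hn2⟩ := hnb
    push Not at hn1 hn2
    obtain ⟨z, hz, hxz, hzy⟩ := hn1
    obtain ⟨z', hz', hout⟩ := hn2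
    have hz'out : ¬ (x ≤ z' ∧ z' ≤ y) := fun h => absurd (hout h.1) (not_lt.2 h.2)
    by_cases hin : (x ≤ u ∧ u ≤ y) ∧ (x ≤ w ∧ w ≤ y)
    · refine ih _ ?_ (X := X.filter fun a => x ≤ a ∧ a ≤ y) ⟨?_, ?_⟩
        (Finset.mem_filter.2 ⟨hu, hin.1⟩) (Finset.mem_filter.2 ⟨hw, hin.2⟩) rfl
      · rw [← hN]
        exact Finset.card_lt_card (Finset.filter_ssubset.2 ⟨z', hz', hz'out⟩)
      · refine Finset.two_lt_card.2 ⟨x, ?_, z, ?_, y, ?_, hxz.ne, hxy.ne, hzy.ne⟩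
        · exact Finset.mem_filter.2 ⟨hx, le_rfl, hxy.le⟩
        · exact Finset.mem_filter.2 ⟨hz, hxz.le, hzy.le⟩
        · exact Finset.mem_filter.2 ⟨hy, hxy.le, le_rfl⟩
      · intro a ha b hb hab hnab
        rw [Finset.mem_filter] at ha hb
        rcases hnab with h | h
        · refine hX.2 a ha.1 b hb.1 hab (Or.inl fun c hc hacb => h c ?_ hacb)
          exact Finset.mem_filter.2 ⟨hc, ha.2.1.trans hacb.1.le, hacb.2.le.trans hb.2.2⟩
        · have h1 : a = x := le_antisymm
            (h x (Finset.mem_filter.2 ⟨hx, le_rfl, hxy.le⟩)).1 ha.2.1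
          have h2 : b = y := le_antisymm hb.2.2
            (h y (Finset.mem_filter.2 ⟨hy, hxy.le, le_rfl⟩)).2
          rw [h1, h2]
          exact hExy
    · have hu' : ¬ (x < u ∧ u < y) := by
        rintro ⟨h1, h2⟩
        exact hin ⟨⟨h1.le, h2.le⟩, h1.le.trans huw.1.le, huw.ge_of_gt h2⟩
      have hw' : ¬ (x < w ∧ w < y) := by
        rintro ⟨h1, h2⟩
        exact hin ⟨⟨huw.le_of_lt h1, huw.1.le.trans h2.le⟩, h1.le, h2.le⟩
      have hxm : x ∈ X.filter fun a => ¬ (x < a ∧ a < y) :=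
        Finset.mem_filter.2 ⟨hx, fun h => lt_irrefl _ h.1⟩
      have hym : y ∈ X.filter fun a => ¬ (x < a ∧ a < y) :=
        Finset.mem_filter.2 ⟨hy, fun h => lt_irrefl _ h.2⟩
      refine ih _ ?_ (X := X.filter fun a => ¬ (x < a ∧ a < y)) ⟨?_, ?_⟩
        (Finset.mem_filter.2 ⟨hu, hu'⟩) (Finset.mem_filter.2 ⟨hw, hw'⟩) rfl
      · rw [← hN]
        exact Finset.card_lt_card (Finset.filter_ssubset.2 ⟨z, hz, not_not.2 ⟨hxz, hzy⟩⟩)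
      · refine Finset.two_lt_card.2 ⟨x, hxm, y, hym, z', ?_, hxy.ne, ?_, ?_⟩
        · exact Finset.mem_filter.2 ⟨hz', fun h => hz'out ⟨h.1.le, h.2.le⟩⟩
        · rintro rfl; exact hz'out ⟨le_rfl, hxy.le⟩
        · rintro rfl; exact hz'out ⟨hxy.le, le_rfl⟩
      · intro a ha b hb hab hnab
        have haX := (Finset.mem_filter.1 ha).1
        have ha2 := (Finset.mem_filter.1 ha).2
        have hbX := (Finset.mem_filter.1 hb).1
        have hb2 := (Finset.mem_filter.1 hb).2
        by_cases hXab : CyclicNeighbors X a b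
        · exact hX.2 a haX b hbX hab hXab
        unfold CyclicNeighbors at hXab
        rw [not_or] at hXab
        obtain ⟨hm1, hm2⟩ := hXab
        push Not at hm1 hm2
        -- The pair became neighbours only by removing vertices strictly between `x` and `y`, so it
        -- is the chord `x y` itself.
        rcases hnab with h | h
        · obtain ⟨c, hc, hac, hcb⟩ := hm1
          have hcin : x < c ∧ c < y := by
            by_contra hcon
            exact h c (Finset.mem_filter.2 ⟨hc, hcon⟩) ⟨hac, hcb⟩
          have h1 : a ≤ x := not_lt.1 fun hlt => ha2 ⟨hlt, hac.trans hcin.2⟩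
          have h2 : y ≤ b := not_lt.1 fun hlt => hb2 ⟨hcin.1.trans hcb, hlt⟩
          have h3 : x ≤ a := not_lt.1 fun hlt => h x hxm ⟨hlt, hcin.1.trans hcb⟩
          have h4 : b ≤ y := not_lt.1 fun hlt => h y hym ⟨hac.trans hcin.2, hlt⟩
          rw [le_antisymm h1 h3, le_antisymm h4 h2]
          exact hExy
        · exfalso
          obtain ⟨c, hc, hcout⟩ := hm2
          have hcin : x < c ∧ c < y := by
            by_contra hcon
            have := h c (Finset.mem_filter.2 ⟨hc, hcon⟩)
            exact absurd (hcout this.1) (not_lt.2 this.2)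
          have h1 := (h x hxm).1
          have h2 := (h y hym).2
          exact absurd (hcout (h1.trans hcin.1.le)) (not_lt.2 (hcin.2.le.trans h2))

/-- The vertices between two successive bridging arcs form a closed polygon. -/
theorem isClosedPolygon_ladder (hcov : ∀ u v, u ⋖ v → E u v) {x x' y y' : V} (hxx : x ≤ x')
    (hyy : y' ≤ y) (hxy' : x' < y') (h1 : E x y) (h2 : E x' y') {X : Finset V}
    (hX : ∀ z, z ∈ X ↔ (x ≤ z ∧ z ≤ x') ∨ (y' ≤ z ∧ z ≤ y)) (hcard : 3 ≤ X.card) :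
    IsClosedPolygon E X := by
  refine ⟨hcard, fun a ha b hb hab hn => ?_⟩
  have hxX : x ∈ X := (hX x).2 (Or.inl ⟨le_rfl, hxx⟩)
  have hxX' : x' ∈ X := (hX x').2 (Or.inl ⟨hxx, le_rfl⟩)
  have hyX : y ∈ X := (hX y).2 (Or.inr ⟨hyy, le_rfl⟩)
  have hyX' : y' ∈ X := (hX y').2 (Or.inr ⟨le_rfl, hyy⟩)
  rcases hn with h | h
  · rcases (hX a).1 ha with ha' | ha'
    · rcases (hX b).1 hb with hb' | hb'
      · refine hcov a b ⟨hab, fun c hac hcb => h c ?_ ⟨hac, hcb⟩⟩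
        exact (hX c).2 (Or.inl ⟨ha'.1.trans hac.le, hcb.le.trans hb'.2⟩)
      · have e1 : a = x' := le_antisymm ha'.2
          (not_lt.1 fun hlt => h x' hxX' ⟨hlt, hxy'.trans_le hb'.1⟩)
        have e2 : b = y' := le_antisymm
          (not_lt.1 fun hlt => h y' hyX' ⟨ha'.2.trans_lt hxy', hlt⟩) hb'.1
        rw [e1, e2]
        exact h2
    · have hb' : b ≤ y := by
        rcases (hX b).1 hb with hb' | hb'
        · exact (hb'.2.trans hxy'.le).trans hyy
        · exact hb'.2
      refine hcov a b ⟨hab, fun c hac hcb => h c ?_ ⟨hac, hcb⟩⟩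
      exact (hX c).2 (Or.inr ⟨ha'.1.trans hac.le, hcb.le.trans hb'⟩)
  · have hxall : x ≤ a := by
      rcases (hX a).1 ha with h | h
      · exact h.1
      · exact (hxx.trans hxy'.le).trans h.1
    have hyall : b ≤ y := by
      rcases (hX b).1 hb with h | h
      · exact (h.2.trans hxy'.le).trans hyy
      · exact h.2
    rw [le_antisymm (h x hxX).1 hxall, le_antisymm hyall (h y hyX).2]
    exact h1

theorem IsSubgon.map (τ : V ≃o V) (hτ : ∀ x y, E (τ x) (τ y) ↔ E x y) (hP : IsSubgon E P) :
    IsSubgon E (P.map τ.toEquiv.toEmbedding) := by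
  refine ⟨by rw [Finset.card_map]; exact hP.1, ?_⟩
  simp only [Finset.forall_mem_map, CyclicNeighbors]
  intro x hx y hy hxy
  have h := hP.2 x hx y hy (τ.lt_iff_lt.1 hxy)
  rw [CyclicNeighbors, ← hτ] at h
  simpa using h

/-- In a dissection whose boundary vertices are `v i`, the sizes of the subgons at the boundary
edges are a consistent choice of common elements of consecutive size multisets. -/
theorem exists_sizes_at_edges (hE : NonCrossing E) (v : ℤ → V) (hv : ∀ i, v i ⋖ v (i + 1))
    (hpoly : ∀ i, ∃ X, IsClosedPolygon E X ∧ v i ∈ X ∧ v (i + 1) ∈ X) (n : ℕ) (τ : V ≃o V)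
    (hτ : ∀ x y, E (τ x) (τ y) ↔ E x y) (hτv : ∀ i, τ (v i) = v (i + n)) (A : ℤ → Multiset ℕ)
    (hA : ∀ i, HasSubgonSizes E (v i) (A i)) :
    ∃ p : ℤ → ℕ, (∀ i, p (i + n) = p i) ∧ (∀ i, p i ∈ A i ∩ A (i + 1)) ∧
      ∀ i, 1 < (A i).card → {p (i - 1), p i} ≤ A i := by
  choose C hC hAC using hA
  have hP : ∀ i, ∃ P, IsSubgon E P ∧ v i ∈ P ∧ v (i + 1) ∈ P := fun i => by
    obtain ⟨X, hX, h1, h2⟩ := hpoly i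
    exact exists_isSubgon_of_covBy (hv i) hX h1 h2
  choose P hP h1 h2 using hP
  refine ⟨fun i => (P i).card, fun i => ?_, fun i => ?_, fun i hi => ?_⟩
  · have hm := (hP i).map τ hτ
    have : P (i + n) = (P i).map τ.toEquiv.toEmbedding := by
      refine (hP _).eq_of_covBy hE hm (hv _) (h1 _) (h2 _) ?_ ?_
      · rw [← hτv]; exact Finset.mem_map_of_mem _ (h1 i)
      · have := Finset.mem_map_of_mem τ.toEquiv.toEmbedding (h2 i)
        rwa [show τ.toEquiv.toEmbedding (v (i + 1)) = v (i + n + 1) from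
          (hτv (i + 1)).trans (by congr 1; ring)] at this
    simp only [this, Finset.card_map]
  · rw [Multiset.mem_inter, hAC, hAC]
    exact ⟨Multiset.mem_map_of_mem _ ((hC i _).2 ⟨hP i, h1 i⟩),
      Multiset.mem_map_of_mem _ ((hC (i + 1) _).2 ⟨hP i, h2 i⟩)⟩
  · have h2' : v i ∈ P (i - 1) := by simpa using h2 (i - 1)
    have hv' : v (i - 1) ⋖ v i := by simpa using hv (i - 1)
    have hne : P (i - 1) ≠ P i := by
      intro heq
      have hone : C i ⊆ {P i} := by
        intro Q hQ
        rw [hC] at hQ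
        rw [Finset.mem_singleton]
        exact (hP i).eq_of_both_edges hE hQ.1 hv' (hv i) (heq ▸ h1 (i - 1)) (h1 i) (h2 i) hQ.2
      have := Finset.card_le_card hone
      rw [hAC, Multiset.card_map, Finset.card_val] at hi
      simp at this
      omega
    rw [hAC]
    -- The inclusion is taken between sets of subgons, before passing to sizes, so that equal sizes
    -- keep their multiplicity.
    have hle : ({P (i - 1), P i} : Finset (Finset V)).val ≤ (C i).val := by
      rw [Finset.val_le_iff]
      intro Q hQ
      rw [Finset.mem_insert, Finset.mem_singleton] at hQ
      rcases hQ with rfl | rfl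
      · exact (hC i _).2 ⟨hP _, h2'⟩
      · exact (hC i _).2 ⟨hP _, h1 i⟩
    have := Multiset.map_le_map (f := Finset.card) hle
    rw [Finset.insert_val_of_notMem (by rwa [Finset.mem_singleton])] at this
    simpa using this

/-- The subgons of a dissection without peripheral arcs, whose bridging arcs `xs t`, `ys t` are
enumerated from left to right. -/
theorem hasSubgonSizes_of_arcs {xs ys : ℤ → V} (hxs : Monotone xs) (hys : Antitone ys)
    (hxy : ∀ t, xs t < ys t)
    (hE : ∀ u v, u < v → (E u v ↔ u ⋖ v ∨ ∃ t, u = xs t ∧ v = ys t))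
    {X : ℤ → Finset V} (hcard : ∀ t, 3 ≤ (X t).card)
    (hX : ∀ t z, z ∈ X t ↔ (xs t ≤ z ∧ z ≤ xs (t + 1)) ∨ (ys (t + 1) ≤ z ∧ z ≤ ys t))
    (v : V) (T : Finset ℤ) (hT : ∀ t, t ∈ T ↔ v ∈ X t) :
    HasSubgonSizes E v (T.val.map fun t => (X t).card) := by
  have hlt : ∀ s t, xs s < ys t := by
    intro s t
    rcases le_total s t with h | h
    · exact (hxs h).trans_lt (hxy t)
    · exact (hxy s).trans_le (hys h)
  have hsucc : ∀ t : ℤ, t ≤ t + 1 := fun t => by omega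
  have hcov : ∀ u v, u ⋖ v → E u v := fun u v h => (hE u v h.1).2 (Or.inl h)
  have harc : ∀ t, E (xs t) (ys t) := fun t => (hE _ _ (hxy t)).2 (Or.inr ⟨t, rfl, rfl⟩)
  have hxX : ∀ t, xs t ∈ X t := fun t => (hX t _).2 (Or.inl ⟨le_rfl, hxs (hsucc t)⟩)
  have hyX : ∀ t, ys t ∈ X t := fun t => (hX t _).2 (Or.inr ⟨hys (hsucc t), le_rfl⟩)
  have hall : ∀ t, ∀ z ∈ X t, xs t ≤ z ∧ z ≤ ys t := by
    intro t z hz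
    rcases (hX t z).1 hz with h | h
    · exact ⟨h.1, h.2.trans (hlt _ _).le⟩
    · exact ⟨(hlt _ _).le.trans h.1, h.2⟩
  have hNC : NonCrossing E := by
    intro a b c d hac hcb hbd h1 h2
    rcases (hE a b (hac.trans hcb)).1 h1 with h | ⟨t, rfl, rfl⟩
    · exact h.2 hac hcb
    rcases (hE c d (hcb.trans hbd)).1 h2 with h | ⟨s, rfl, rfl⟩
    · exact h.2 hcb hbd
    rcases le_total s t with h | h
    · exact absurd hac (not_lt.2 (hxs h))
    · exact absurd hbd (not_lt.2 (hys h))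
  have hsub : ∀ t, IsSubgon E (X t) := by
    intro t
    have hcl := isClosedPolygon_ladder hcov (hxs (hsucc t)) (hys (hsucc t)) (hxy (t + 1))
      (harc t) (harc (t + 1)) (hX t) (hcard t)
    refine ⟨hcard t, fun x hx y hy hxy' => ⟨fun h => ?_, hcl.2 x hx y hy hxy'⟩⟩
    rcases (hE x y hxy').1 h with h | ⟨s, rfl, rfl⟩
    · exact Or.inl fun z _ hz => h.2 hz.1 hz.2
    · rcases le_or_gt s t with hst | hst
      · exact Or.inr fun z hz => ⟨(hxs hst).trans (hall t z hz).1, (hall t z hz).2.trans (hys hst)⟩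
      · refine Or.inl fun z hz hlt' => ?_
        rcases (hX t z).1 hz with h | h
        · exact absurd hlt'.1 (not_lt.2 (h.2.trans (hxs hst)))
        · exact absurd hlt'.2 (not_lt.2 ((hys hst).trans h.1))
  have hinj : Function.Injective X := by
    have aux : ∀ s t, s < t → X s ≠ X t := by
      intro s t hst heq
      have h1 := (hall t _ (heq ▸ hxX s)).1
      have h2 := (hall t _ (heq ▸ hyX s)).2
      have h3 : xs (s + 1) ≤ xs s := (hxs hst).trans h1
      have h4 : ys s ≤ ys (s + 1) := h2.trans (hys hst)
      have := card_le_two_of_forall (hall s) (by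
        rintro z hz ⟨h5, h6⟩
        rcases (hX s z).1 hz with h | h
        · exact absurd h5 (not_lt.2 (h.2.trans h3))
        · exact absurd h6 (not_lt.2 (h4.trans h.1)))
      have := hcard s
      omega
    intro s t heq
    rcases lt_trichotomy s t with h | h | h
    · exact absurd heq (aux s t h)
    · exact h
    · exact absurd heq.symm (aux t s h)
  refine ⟨T.map ⟨X, hinj⟩, fun Q => ?_, ?_⟩
  · rw [Finset.mem_map]
    constructor
    · rintro ⟨t, ht, rfl⟩
      exact ⟨hsub t, (hT t).1 ht⟩
    · rintro ⟨hQ, hvQ⟩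
      have hne : Q.Nonempty := ⟨v, hvQ⟩
      have hmM : Q.min' hne < Q.max' hne := Finset.min'_lt_max'_of_card Q (by have := hQ.1; omega)
      have hQall : ∀ a ∈ Q, Q.min' hne ≤ a ∧ a ≤ Q.max' hne := fun a ha =>
        ⟨Q.min'_le a ha, Q.le_max' a ha⟩
      have hEd : E (Q.min' hne) (Q.max' hne) :=
        (hQ.2 _ (Q.min'_mem hne) _ (Q.max'_mem hne) hmM).2 (Or.inr hQall)
      -- The first and last vertices of a subgon are joined. A covering pair leaves no room for a
      -- third vertex, so the edge is an arc, and it identifies the subgon.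
      rcases (hE _ _ hmM).1 hEd with h | ⟨t, h1, h2⟩
      · exact (not_all_between_of_covBy h hQ hQall).elim
      · have heq : X t = Q := by
          refine (hsub t).eq_of_extremes hNC hQ (a := xs t) (b := ys t) (hxX t) (hyX t) ?_ ?_
            (hall t) ?_
          · rw [← h1]; exact Q.min'_mem hne
          · rw [← h2]; exact Q.max'_mem hne
          · rw [← h1, ← h2]; exact hQall
        exact ⟨t, (hT t).2 (heq ▸ hvQ), heq⟩
  · rw [Finset.map_val, Multiset.map_map]
    rfl

end Subgons

/-! ### The universal cover of the annulus -/

/-- The upper vertex `w_j` of the strip. -/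
def upperVertex (j : ℤ) : StripVertex := toLex (Sum.inr (OrderDual.toDual j))

theorem StripVertex.cases (x : StripVertex) :
    (∃ i, x = lowerVertex i) ∨ ∃ j, x = upperVertex j := by
  rcases h : ofLex x with a | j
  · exact Or.inl ⟨a, h⟩
  · exact Or.inr ⟨OrderDual.ofDual j, h⟩

@[simp] theorem lowerVertex_inj {a b : ℤ} : lowerVertex a = lowerVertex b ↔ a = b :=
  ⟨fun h => Sum.inl_injective (toLex.injective h), fun h => h ▸ rfl⟩

@[simp] theorem upperVertex_inj {a b : ℤ} : upperVertex a = upperVertex b ↔ a = b :=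
  ⟨fun h => Sum.inr_injective (toLex.injective h), fun h => h ▸ rfl⟩

@[simp] theorem lowerVertex_le {a b : ℤ} : lowerVertex a ≤ lowerVertex b ↔ a ≤ b :=
  Sum.Lex.inl_le_inl_iff

@[simp] theorem upperVertex_le {a b : ℤ} : upperVertex a ≤ upperVertex b ↔ b ≤ a :=
  Sum.Lex.inr_le_inr_iff

@[simp] theorem lowerVertex_lt {a b : ℤ} : lowerVertex a < lowerVertex b ↔ a < b :=
  Sum.Lex.inl_lt_inl_iff

@[simp] theorem upperVertex_lt {a b : ℤ} : upperVertex a < upperVertex b ↔ b < a :=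
  Sum.Lex.inr_lt_inr_iff

@[simp] theorem lowerVertex_lt_upperVertex (a j : ℤ) : lowerVertex a < upperVertex j :=
  Sum.Lex.inl_lt_inr _ _

@[simp] theorem lowerVertex_le_upperVertex (a j : ℤ) : lowerVertex a ≤ upperVertex j :=
  (lowerVertex_lt_upperVertex a j).le

@[simp] theorem not_upperVertex_le_lowerVertex (a j : ℤ) : ¬ upperVertex j ≤ lowerVertex a :=
  not_le.2 (lowerVertex_lt_upperVertex a j)

@[simp] theorem not_upperVertex_lt_lowerVertex (a j : ℤ) : ¬ upperVertex j < lowerVertex a :=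
  not_lt.2 (lowerVertex_le_upperVertex a j)

@[simp] theorem lowerVertex_ne_upperVertex (a j : ℤ) : lowerVertex a ≠ upperVertex j :=
  (lowerVertex_lt_upperVertex a j).ne

@[simp] theorem upperVertex_ne_lowerVertex (a j : ℤ) : upperVertex j ≠ lowerVertex a :=
  (lowerVertex_lt_upperVertex a j).ne'

theorem lowerVertex_covBy {a b : ℤ} : lowerVertex a ⋖ lowerVertex b ↔ b = a + 1 := by
  constructor
  · intro h
    have h1 := lowerVertex_lt.1 h.1
    by_contra hne
    exact h.2 (c := lowerVertex (a + 1)) (lowerVertex_lt.2 (by omega))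
      (lowerVertex_lt.2 (by omega))
  · rintro rfl
    refine ⟨lowerVertex_lt.2 (by omega), fun c h1 h2 => ?_⟩
    rcases c.cases with ⟨k, rfl⟩ | ⟨k, rfl⟩
    · rw [lowerVertex_lt] at h1 h2; omega
    · simp at h2

theorem upperVertex_covBy {a b : ℤ} : upperVertex a ⋖ upperVertex b ↔ a = b + 1 := by
  constructor
  · intro h
    have h1 := upperVertex_lt.1 h.1
    by_contra hne
    exact h.2 (c := upperVertex (b + 1)) (upperVertex_lt.2 (by omega))
      (upperVertex_lt.2 (by omega))
  · rintro rfl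
    refine ⟨upperVertex_lt.2 (by omega), fun c h1 h2 => ?_⟩
    rcases c.cases with ⟨k, rfl⟩ | ⟨k, rfl⟩
    · simp at h1
    · rw [upperVertex_lt] at h1 h2; omega

theorem not_lowerVertex_covBy_upperVertex (a j : ℤ) : ¬ lowerVertex a ⋖ upperVertex j :=
  fun h => h.2 (c := lowerVertex (a + 1)) (lowerVertex_lt.2 (by omega))
    (lowerVertex_lt_upperVertex _ _)

/-- The lower vertices `v_a, …, v_b` and the upper vertices `w_c, …, w_d`. -/
noncomputable def stripLadder (a b c d : ℤ) : Finset StripVertex :=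
  (Finset.Icc a b).image lowerVertex ∪ (Finset.Icc c d).image upperVertex

theorem lowerVertex_mem_stripLadder {a b c d i : ℤ} :
    lowerVertex i ∈ stripLadder a b c d ↔ a ≤ i ∧ i ≤ b := by
  simp [stripLadder]

theorem mem_stripLadder {a b c d : ℤ} (z : StripVertex) : z ∈ stripLadder a b c d ↔
    (lowerVertex a ≤ z ∧ z ≤ lowerVertex b) ∨ (upperVertex d ≤ z ∧ z ≤ upperVertex c) := by
  rcases z.cases with ⟨k, rfl⟩ | ⟨k, rfl⟩
  · simp [stripLadder]
  · simp [stripLadder, and_comm]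

theorem card_stripLadder (a b c d : ℤ) :
    (stripLadder a b c d).card = (b + 1 - a).toNat + (d + 1 - c).toNat := by
  rw [stripLadder, Finset.card_union_of_disjoint, Finset.card_image_of_injective,
    Finset.card_image_of_injective, Int.card_Icc, Int.card_Icc]
  · exact fun _ _ h => upperVertex_inj.1 h
  · exact fun _ _ h => lowerVertex_inj.1 h
  · rw [Finset.disjoint_left]
    intro x h1 h2
    obtain ⟨i, -, rfl⟩ := Finset.mem_image.1 h1
    obtain ⟨j, -, h⟩ := Finset.mem_image.1 h2
    simp at h

namespace AnnulusDissection

variable {n m : ℕ} (D : AnnulusDissection n m)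

theorem edge_lower_lower {a b : ℤ} :
    D.Edge (lowerVertex a) (lowerVertex b) ↔ b = a + 1 ∨ D.peripheral a b := Iff.rfl

theorem edge_lower_upper {a j : ℤ} :
    D.Edge (lowerVertex a) (upperVertex j) ↔ D.bridging a j := Iff.rfl

theorem edge_upper_upper {j k : ℤ} :
    D.Edge (upperVertex j) (upperVertex k) ↔ j = k + 1 := Iff.rfl

theorem edge_upper_lower {j a : ℤ} :
    D.Edge (upperVertex j) (lowerVertex a) ↔ False := Iff.rfl

theorem edge_of_covBy (x y : StripVertex) (h : x ⋖ y) : D.Edge x y := by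
  rcases x.cases with ⟨a, rfl⟩ | ⟨a, rfl⟩ <;> rcases y.cases with ⟨b, rfl⟩ | ⟨b, rfl⟩
  · exact Or.inl (lowerVertex_covBy.1 h)
  · exact absurd h (not_lowerVertex_covBy_upperVertex _ _)
  · exact absurd h.1 (not_upperVertex_lt_lowerVertex _ _)
  · exact upperVertex_covBy.1 h

theorem nonCrossing : NonCrossing D.Edge := by
  intro x y z w hxz hzy hyw h1 h2
  rcases x.cases with ⟨a, rfl⟩ | ⟨a, rfl⟩ <;> rcases y.cases with ⟨b, rfl⟩ | ⟨b, rfl⟩ <;>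
    rcases z.cases with ⟨c, rfl⟩ | ⟨c, rfl⟩ <;> rcases w.cases with ⟨d, rfl⟩ | ⟨d, rfl⟩ <;>
    simp only [edge_lower_lower, edge_lower_upper, edge_upper_upper, lowerVertex_lt,
      upperVertex_lt, not_upperVertex_lt_lowerVertex] at hxz hzy hyw h1 h2
  · rcases h1 with h1 | h1
    · omega
    · rcases h2 with h2 | h2
      · omega
      · exact D.peripheral_noncrossing _ _ _ _ h1 h2 ⟨hxz, hzy, hyw⟩
  · rcases h1 with h1 | h1
    · omega
    · exact D.peripheral_bridging_noncrossing _ _ _ _ h1 h2 ⟨hxz, hzy⟩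
  · exact D.bridging_noncrossing _ _ _ _ h1 h2 ⟨hxz, hyw⟩
  · omega
  · omega

/-- The generator of the deck group. -/
noncomputable def deck (n m : ℕ) : StripVertex ≃o StripVertex :=
  OrderIso.sumLexCongr (OrderIso.addRight (n : ℤ)) (OrderIso.addRight (m : ℤ)).dual

theorem deck_lower (i : ℤ) : deck n m (lowerVertex i) = lowerVertex (i + n) := rfl

theorem deck_upper (j : ℤ) : deck n m (upperVertex j) = upperVertex (j + m) := rfl

theorem edge_deck (x y : StripVertex) : D.Edge (deck n m x) (deck n m y) ↔ D.Edge x y := by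
  rcases x.cases with ⟨a, rfl⟩ | ⟨a, rfl⟩ <;> rcases y.cases with ⟨b, rfl⟩ | ⟨b, rfl⟩ <;>
    simp only [edge_lower_lower, edge_lower_upper, edge_upper_upper, edge_upper_lower,
      deck_lower, deck_upper]
  · rw [D.peripheral_deck]
    exact or_congr_left (by omega)
  · exact D.bridging_deck a b
  · omega

theorem bridging_deck_mul (k i j : ℤ) : D.bridging (i + k * n) (j + k * m) ↔ D.bridging i j := by
  induction k using Int.induction_on with
  | zero => simp
  | succ k ih =>
    rw [← ih, ← D.bridging_deck (i + k * n)]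
    ring_nf
  | pred k ih =>
    rw [← ih, ← D.bridging_deck (i + (-k - 1) * n)]
    ring_nf

/-- A bridging arc and its next deck translate bound a fundamental domain. The floor quotient `k`
selects the translate whose domain contains the edge from `v_i` to `v_{i+1}`. -/
theorem exists_closedPolygon (hn : 1 ≤ n) (i : ℤ) : ∃ X, IsClosedPolygon D.Edge X ∧
    lowerVertex i ∈ X ∧ lowerVertex (i + 1) ∈ X := by
  obtain ⟨a, j, h⟩ := D.exists_bridging
  have hn' : (0 : ℤ) < n := by exact_mod_cast hn
  set k : ℤ := (i - a) / n with hk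
  have hk1 : k * n ≤ i - a := Int.ediv_mul_le _ hn'.ne'
  have hk2 : i - a < (k + 1) * n := Int.lt_ediv_add_one_mul_self _ hn'
  have h1 := (D.bridging_deck_mul k a j).2 h
  have h2 := (D.bridging_deck_mul (k + 1) a j).2 h
  have hle : j + k * m ≤ j + (k + 1) * m := by nlinarith [Int.natCast_nonneg m]
  refine ⟨stripLadder (a + k * n) (a + (k + 1) * n) (j + k * m) (j + (k + 1) * m), ?_, ?_, ?_⟩
  · refine isClosedPolygon_ladder D.edge_of_covBy ?_ ?_ (lowerVertex_lt_upperVertex _ _)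
      (D.edge_lower_upper.2 h1) (D.edge_lower_upper.2 h2) mem_stripLadder ?_
    · rw [lowerVertex_le]; omega
    · rw [upperVertex_le]; exact hle
    · rw [card_stripLadder]
      omega
  · rw [lowerVertex_mem_stripLadder]; omega
  · rw [lowerVertex_mem_stripLadder]; omega

theorem exists_sizes_at_edges (hn : 1 ≤ n) (A : ℤ → Multiset ℕ) (hA : ∀ i, D.SizesAt i (A i)) :
    ∃ p : ℤ → ℕ, (∀ i, p (i + n) = p i) ∧ (∀ i, p i ∈ A i ∩ A (i + 1)) ∧
      ∀ i, 1 < (A i).card → {p (i - 1), p i} ≤ A i :=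
  FriezeDissection.exists_sizes_at_edges D.nonCrossing lowerVertex
    (fun _ => lowerVertex_covBy.2 rfl) (D.exists_closedPolygon hn) n (deck n m) D.edge_deck
    deck_lower A hA

end AnnulusDissection

/-! ### The universal cover of the once-punctured disc -/

theorem WithTop.int_covBy {a b : ℤ} : (a : WithTop ℤ) ⋖ b ↔ b = a + 1 := by
  constructor
  · intro h
    have h1 : a < b := WithTop.coe_lt_coe.1 h.1
    by_contra hne
    exact h.2 (c := ((a + 1 : ℤ) : WithTop ℤ)) (WithTop.coe_lt_coe.2 (by omega))
      (WithTop.coe_lt_coe.2 (by omega))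
  · rintro rfl
    refine ⟨WithTop.coe_lt_coe.2 (by omega), fun c h1 h2 => ?_⟩
    induction c using WithTop.recTopCoe with
    | top => exact absurd h2 not_top_lt
    | coe c =>
      have h3 : a < c := WithTop.coe_lt_coe.1 h1
      have h4 : c < a + 1 := WithTop.coe_lt_coe.1 h2
      omega

theorem WithTop.not_int_covBy_top (a : ℤ) : ¬ (a : WithTop ℤ) ⋖ ⊤ :=
  fun h => h.2 (c := ((a + 1 : ℤ) : WithTop ℤ)) (WithTop.coe_lt_coe.2 (by omega))
    (WithTop.coe_lt_top _)

/-- The boundary vertices `v_a, …, v_b` and the puncture. -/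
noncomputable def puncturedLadder (a b : ℤ) : Finset (WithTop ℤ) :=
  insert ⊤ ((Finset.Icc a b).image ((↑) : ℤ → WithTop ℤ))

theorem coe_mem_puncturedLadder {a b i : ℤ} :
    (i : WithTop ℤ) ∈ puncturedLadder a b ↔ a ≤ i ∧ i ≤ b := by
  simp [puncturedLadder]

theorem mem_puncturedLadder {a b : ℤ} (z : WithTop ℤ) : z ∈ puncturedLadder a b ↔
    ((a : WithTop ℤ) ≤ z ∧ z ≤ b) ∨ (⊤ ≤ z ∧ z ≤ ⊤) := by
  induction z using WithTop.recTopCoe with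
  | top => simp [puncturedLadder]
  | coe z => simp [puncturedLadder]

theorem card_puncturedLadder (a b : ℤ) :
    (puncturedLadder a b).card = (b + 1 - a).toNat + 1 := by
  rw [puncturedLadder, Finset.card_insert_of_notMem, Finset.card_image_of_injective, Int.card_Icc]
  · exact WithTop.coe_injective
  · simp

namespace PuncturedDiscDissection

variable {n : ℕ} (D : PuncturedDiscDissection n)

theorem edge_coe_coe {a b : ℤ} :
    D.Edge (a : WithTop ℤ) (b : WithTop ℤ) ↔ b = a + 1 ∨ D.peripheral a b := by
  constructor
  · rintro (⟨a', b', h1, h2, h⟩ | ⟨a', -, h2, -⟩)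
    · rw [WithTop.coe_inj] at h1 h2
      subst h1 h2
      exact h
    · exact absurd h2 WithTop.coe_ne_top
  · exact fun h => Or.inl ⟨a, b, rfl, rfl, h⟩

theorem edge_coe_top {a : ℤ} : D.Edge (a : WithTop ℤ) ⊤ ↔ D.bridging a := by
  constructor
  · rintro (⟨a', b', -, h2, -⟩ | ⟨a', h1, -, h⟩)
    · exact absurd h2 WithTop.top_ne_coe
    · rw [WithTop.coe_inj] at h1
      subst h1
      exact h
  · exact fun h => Or.inr ⟨a, rfl, rfl, h⟩

theorem edge_top {y : WithTop ℤ} : D.Edge ⊤ y ↔ False := by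
  refine ⟨?_, False.elim⟩
  rintro (⟨a', b', h1, -⟩ | ⟨a', h1, -⟩) <;> exact absurd h1 WithTop.top_ne_coe

theorem edge_of_covBy (x y : WithTop ℤ) (h : x ⋖ y) : D.Edge x y := by
  induction x using WithTop.recTopCoe with
  | top => exact absurd h.1 not_top_lt
  | coe a =>
    induction y using WithTop.recTopCoe with
    | top => exact absurd h (WithTop.not_int_covBy_top a)
    | coe b => exact D.edge_coe_coe.2 (Or.inl (WithTop.int_covBy.1 h))

theorem nonCrossing : NonCrossing D.Edge := by
  intro x y z w hxz hzy hyw h1 h2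
  obtain ⟨a, rfl⟩ := WithTop.ne_top_iff_exists.1 (hxz.trans_le le_top).ne
  obtain ⟨c, rfl⟩ := WithTop.ne_top_iff_exists.1 (hzy.trans_le le_top).ne
  obtain ⟨b, rfl⟩ := WithTop.ne_top_iff_exists.1 (hyw.trans_le le_top).ne
  rw [edge_coe_coe] at h1
  have h3 : a < c := WithTop.coe_lt_coe.1 hxz
  have h4 : c < b := WithTop.coe_lt_coe.1 hzy
  have h5 := h1.resolve_left (by omega)
  induction w using WithTop.recTopCoe with
  | top => exact D.peripheral_bridging_noncrossing _ _ _ h5 (D.edge_coe_top.1 h2) ⟨h3, h4⟩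
  | coe d =>
    have h6 : b < d := WithTop.coe_lt_coe.1 hyw
    exact D.peripheral_noncrossing _ _ _ _ h5 ((D.edge_coe_coe.1 h2).resolve_left (by omega))
      ⟨h3, h4, h6⟩

/-- The generator of the deck group. -/
noncomputable def deck (n : ℕ) : WithTop ℤ ≃o WithTop ℤ := (OrderIso.addRight (n : ℤ)).withTopCongr

theorem deck_coe (i : ℤ) : deck n (i : WithTop ℤ) = ((i + n : ℤ) : WithTop ℤ) := rfl

theorem deck_top : deck n ⊤ = ⊤ := rfl

theorem edge_deck (x y : WithTop ℤ) : D.Edge (deck n x) (deck n y) ↔ D.Edge x y := by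
  induction x using WithTop.recTopCoe with
  | top => rw [deck_top, edge_top, edge_top]
  | coe a =>
    induction y using WithTop.recTopCoe with
    | top => rw [deck_top, deck_coe, edge_coe_top, edge_coe_top, D.bridging_deck]
    | coe b =>
      rw [deck_coe, deck_coe, edge_coe_coe, edge_coe_coe, D.peripheral_deck]
      exact or_congr_left (by omega)

theorem bridging_deck_mul (k i : ℤ) : D.bridging (i + k * n) ↔ D.bridging i := by
  induction k using Int.induction_on with
  | zero => simp
  | succ k ih =>
    rw [← ih, ← D.bridging_deck (i + k * n)]
    ring_nf
  | pred k ih =>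
    rw [← ih, ← D.bridging_deck (i + (-k - 1) * n)]
    ring_nf

theorem exists_closedPolygon (hn : 1 ≤ n) (i : ℤ) : ∃ X, IsClosedPolygon D.Edge X ∧
    (i : WithTop ℤ) ∈ X ∧ ((i + 1 : ℤ) : WithTop ℤ) ∈ X := by
  obtain ⟨a, h⟩ := D.exists_bridging
  have hn' : (0 : ℤ) < n := by exact_mod_cast hn
  set k : ℤ := (i - a) / n with hk
  have hk1 : k * n ≤ i - a := Int.ediv_mul_le _ hn'.ne'
  have hk2 : i - a < (k + 1) * n := Int.lt_ediv_add_one_mul_self _ hn'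
  have h1 := (D.bridging_deck_mul k a).2 h
  have h2 := (D.bridging_deck_mul (k + 1) a).2 h
  refine ⟨puncturedLadder (a + k * n) (a + (k + 1) * n), ?_, ?_, ?_⟩
  · refine isClosedPolygon_ladder D.edge_of_covBy ?_ le_rfl (WithTop.coe_lt_top _)
      (D.edge_coe_top.2 h1) (D.edge_coe_top.2 h2) mem_puncturedLadder ?_
    · rw [WithTop.coe_le_coe]; omega
    · rw [card_puncturedLadder]
      omega
  · rw [coe_mem_puncturedLadder]; omega
  · rw [coe_mem_puncturedLadder]; omega

theorem exists_sizes_at_edges (hn : 1 ≤ n) (A : ℤ → Multiset ℕ) (hA : ∀ i, D.SizesAt i (A i)) :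
    ∃ p : ℤ → ℕ, (∀ i, p (i + n) = p i) ∧ (∀ i, p i ∈ A i ∩ A (i + 1)) ∧
      ∀ i, 1 < (A i).card → {p (i - 1), p i} ≤ A i :=
  FriezeDissection.exists_sizes_at_edges D.nonCrossing (fun i : ℤ => (i : WithTop ℤ))
    (fun _ => WithTop.int_covBy.2 rfl) (D.exists_closedPolygon hn) n (deck n) D.edge_deck
    deck_coe A hA

end PuncturedDiscDissection

theorem three_le_of_hasSubgonSizes {V : Type*} [LinearOrder V] {E : V → V → Prop} {v : V}
    {A : Multiset ℕ} (h : HasSubgonSizes E v A) : ∀ p ∈ A, 3 ≤ p := by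
  obtain ⟨C, hC, rfl⟩ := h
  intro p hp
  obtain ⟨P, hP, rfl⟩ := Multiset.mem_map.1 hp
  exact ((hC P).1 hP).1.1

/-! ### Dissections given by a sequence of bridging arcs -/

/-- The dissection of `A_{n,m}` with bridging arcs `α t`, `β t` and no peripheral arcs. -/
def annulusOfArcs {n m : ℕ} {α β : ℤ → ℤ} (hα : Monotone α) (hβ : Monotone β) (c : ℤ)
    (hαc : ∀ t, α (t + c) = α t + n) (hβc : ∀ t, β (t + c) = β t + m) :
    AnnulusDissection n m where
  bridging i j := ∃ t, α t = i ∧ β t = j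
  peripheral _ _ := False
  bridging_deck i j := by
    constructor
    · rintro ⟨t, h1, h2⟩
      refine ⟨t - c, ?_, ?_⟩
      · have := hαc (t - c)
        rw [sub_add_cancel] at this
        omega
      · have := hβc (t - c)
        rw [sub_add_cancel] at this
        omega
    · rintro ⟨t, h1, h2⟩
      exact ⟨t + c, by rw [hαc, h1], by rw [hβc, h2]⟩
  peripheral_deck _ _ := Iff.rfl
  not_boundary _ _ h := h.elim
  bridging_noncrossing := by
    rintro _ _ _ _ ⟨s, rfl, rfl⟩ ⟨t, rfl, rfl⟩ ⟨h1, h2⟩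
    rcases le_total s t with h | h
    · exact absurd h2 (not_lt.2 (hβ h))
    · exact absurd h1 (not_lt.2 (hα h))
  peripheral_noncrossing _ _ _ _ h := h.elim
  peripheral_bridging_noncrossing _ _ _ _ h := h.elim
  exists_bridging := ⟨α 0, β 0, 0, rfl, rfl⟩

/-- Polygon `t` lies between arcs `t` and `t + 1`; in `hsum` its edges are the lower ones, the upper
ones and the two bridging sides. -/
theorem annulusOfArcs_sizesAt {n m : ℕ} {α β : ℤ → ℤ} (hα : Monotone α) (hβ : Monotone β) (c : ℤ)
    (hαc : ∀ t, α (t + c) = α t + n) (hβc : ∀ t, β (t + c) = β t + m) (s : ℤ → ℕ)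
    (hs : ∀ t, 3 ≤ s t)
    (hsum : ∀ t, (s t : ℤ) = (α (t + 1) - α t) + (β (t + 1) - β t) + 2) (i : ℤ) (T : Finset ℤ)
    (hT : ∀ t, t ∈ T ↔ α t ≤ i ∧ i ≤ α (t + 1)) :
    (annulusOfArcs hα hβ c hαc hβc).SizesAt i (T.val.map s) := by
  have hcard : ∀ t, (stripLadder (α t) (α (t + 1)) (β t) (β (t + 1))).card = s t := by
    intro t
    have h1 : α t ≤ α (t + 1) := hα (by omega)
    have h2 : β t ≤ β (t + 1) := hβ (by omega)
    have := hsum t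
    rw [card_stripLadder]
    omega
  have := hasSubgonSizes_of_arcs (E := (annulusOfArcs hα hβ c hαc hβc).Edge)
    (xs := fun t => lowerVertex (α t)) (ys := fun t => upperVertex (β t))
    (fun _ _ h => lowerVertex_le.2 (hα h)) (fun _ _ h => upperVertex_le.2 (hβ h))
    (fun _ => lowerVertex_lt_upperVertex _ _) ?_
    (X := fun t => stripLadder (α t) (α (t + 1)) (β t) (β (t + 1)))
    (fun t => by rw [hcard]; exact hs t) (fun t => mem_stripLadder) (lowerVertex i) T
    (fun t => by rw [hT, lowerVertex_mem_stripLadder])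
  · simp only [hcard] at this
    exact this
  · intro u v huv
    rcases u.cases with ⟨a, rfl⟩ | ⟨a, rfl⟩ <;> rcases v.cases with ⟨b, rfl⟩ | ⟨b, rfl⟩
    · rw [AnnulusDissection.edge_lower_lower, lowerVertex_covBy]
      simp [annulusOfArcs]
    · rw [AnnulusDissection.edge_lower_upper]
      simp [annulusOfArcs, not_lowerVertex_covBy_upperVertex, eq_comm]
    · simp at huv
    · rw [AnnulusDissection.edge_upper_upper, upperVertex_covBy]
      simp

/-- The dissection of `S_n` with bridging arcs `α t` and no peripheral arcs. -/
def puncturedOfArcs {n : ℕ} {α : ℤ → ℤ} (c : ℤ) (hαc : ∀ t, α (t + c) = α t + n) :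
    PuncturedDiscDissection n where
  bridging i := ∃ t, α t = i
  peripheral _ _ := False
  bridging_deck i := by
    constructor
    · rintro ⟨t, h1⟩
      refine ⟨t - c, ?_⟩
      have := hαc (t - c)
      rw [sub_add_cancel] at this
      omega
    · rintro ⟨t, h1⟩
      exact ⟨t + c, by rw [hαc, h1]⟩
  peripheral_deck _ _ := Iff.rfl
  not_boundary _ _ h := h.elim
  peripheral_noncrossing _ _ _ _ h := h.elim
  peripheral_bridging_noncrossing _ _ _ h := h.elim
  exists_bridging := ⟨α 0, 0, rfl⟩

theorem puncturedOfArcs_sizesAt {n : ℕ} {α : ℤ → ℤ} (hα : Monotone α) (c : ℤ)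
    (hαc : ∀ t, α (t + c) = α t + n) (s : ℤ → ℕ) (hs : ∀ t, 3 ≤ s t)
    (hsum : ∀ t, (s t : ℤ) = (α (t + 1) - α t) + 2) (i : ℤ) (T : Finset ℤ)
    (hT : ∀ t, t ∈ T ↔ α t ≤ i ∧ i ≤ α (t + 1)) :
    (puncturedOfArcs c hαc).SizesAt i (T.val.map s) := by
  have hcard : ∀ t, (puncturedLadder (α t) (α (t + 1))).card = s t := by
    intro t
    have h1 : α t ≤ α (t + 1) := hα (by omega)
    have := hsum t
    rw [card_puncturedLadder]
    omega
  have := hasSubgonSizes_of_arcs (E := (puncturedOfArcs c hαc).Edge)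
    (xs := fun t => (α t : WithTop ℤ)) (ys := fun _ => ⊤)
    (fun _ _ h => WithTop.coe_le_coe.2 (hα h)) (fun _ _ _ => le_rfl)
    (fun _ => WithTop.coe_lt_top _) ?_
    (X := fun t => puncturedLadder (α t) (α (t + 1)))
    (fun t => by rw [hcard]; exact hs t) (fun t => mem_puncturedLadder) (i : WithTop ℤ) T
    (fun t => by rw [hT, coe_mem_puncturedLadder])
  · simp only [hcard] at this
    exact this
  · intro u v huv
    obtain ⟨a, rfl⟩ := WithTop.ne_top_iff_exists.1 (huv.trans_le le_top).ne
    induction v using WithTop.recTopCoe with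
    | top =>
      rw [PuncturedDiscDissection.edge_coe_top]
      simp only [puncturedOfArcs, WithTop.not_int_covBy_top, false_or, WithTop.coe_inj, and_true,
        eq_comm]
    | coe b =>
      rw [PuncturedDiscDissection.edge_coe_coe, WithTop.int_covBy]
      simp [puncturedOfArcs]

/-! ### Periodic sequences of integers -/

theorem exists_partial_sums (c : ℤ → ℤ) : ∃ C : ℤ → ℤ, ∀ i, C (i + 1) = C i + c i := by
  refine ⟨fun i => ∑ j ∈ Finset.range i.toNat, c j -
    ∑ j ∈ Finset.range (-i).toNat, c (-(j + 1)), fun i => ?_⟩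
  rcases le_or_gt 0 i with h | h
  · have e1 : (i + 1).toNat = i.toNat + 1 := by omega
    have e2 : (-(i + 1)).toNat = 0 := by omega
    have e3 : (-i).toNat = 0 := by omega
    have e4 : (i.toNat : ℤ) = i := by omega
    simp only [e1, e2, e3, Finset.sum_range_succ, e4, Finset.range_zero, Finset.sum_empty]
    ring
  · have e1 : (-i).toNat = (-(i + 1)).toNat + 1 := by omega
    have e2 : (i + 1).toNat = 0 := by omega
    have e3 : i.toNat = 0 := by omega
    have e4 : (((-(i + 1)).toNat : ℕ) : ℤ) = -(i + 1) := by omega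
    have e5 : -(-(i + 1) + 1) = i := by ring
    simp only [e1, e2, e3, Finset.sum_range_succ, e4, e5, Finset.range_zero, Finset.sum_empty]
    ring

theorem partial_sums_add_period {C c : ℤ → ℤ} (hC : ∀ i, C (i + 1) = C i + c i) {n : ℤ}
    (hc : ∀ i, c (i + n) = c i) (i : ℤ) : C (i + n) = C i + (C n - C 0) := by
  induction i using Int.induction_on with
  | zero => simp
  | succ k ih =>
    have h1 := hC (k + n)
    have h2 := hC k
    have h3 := hc k
    have e : (k : ℤ) + 1 + n = k + n + 1 := by ring
    rw [e]
    linarith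
  | pred k ih =>
    have h1 := hC (-k - 1 + n)
    have h2 := hC (-k - 1)
    have h3 := hc (-k - 1)
    have e1 : -(k : ℤ) - 1 + n + 1 = -k + n := by ring
    have e2 : -(k : ℤ) - 1 + 1 = -k := by ring
    rw [e1] at h1
    rw [e2] at h2
    linarith

theorem monotone_partial_sums {C c : ℤ → ℤ} (hC : ∀ i, C (i + 1) = C i + c i)
    (hc : ∀ i, 0 ≤ c i) : Monotone C :=
  monotone_int_of_le_succ fun i => by have := hC i; have := hc i; omega

/-- The upper adjoint of a monotone sequence with positive drift. -/
theorem exists_upper_adjoint {C : ℤ → ℤ} (hC : Monotone C) {n T : ℤ} (hT : 0 < T)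
    (hper : ∀ i, C (i + n) = C i + T) : ∃ α : ℤ → ℤ, ∀ i t, i ≤ α t ↔ C i ≤ t := by
  have hmul : ∀ k : ℤ, C (k * n) = C 0 + k * T := by
    intro k
    induction k using Int.induction_on with
    | zero => simp
    | succ k ih =>
      rw [add_mul, one_mul, hper, ih]; ring
    | pred k ih =>
      have := hper ((-k - 1) * n)
      have e : (-(k : ℤ) - 1) * n + n = -k * n := by ring
      rw [e, ih] at this
      linarith
  have hex : ∀ t, ∃ a, ∀ i, i ≤ a ↔ C i ≤ t := by
    intro t
    have hb : ∃ b : ℤ, ∀ z : ℤ, C z ≤ t → z ≤ b := by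
      -- After that many periods, each of drift at least 1, `C` has passed `t`.
      refine ⟨(|t| + |C 0| + 1) * n, fun z hz => ?_⟩
      by_contra hlt
      have h1 := hC (not_le.1 hlt).le
      rw [hmul] at h1
      have h2 := le_abs_self t
      have h3 := neg_abs_le (C 0)
      have h4 : |t| + |C 0| + 1 ≤ (|t| + |C 0| + 1) * T :=
        le_mul_of_one_le_right (by positivity) (by omega)
      omega
    have hne : ∃ z : ℤ, C z ≤ t := by
      refine ⟨(-(|t| + |C 0| + 1)) * n, ?_⟩
      rw [hmul]
      have h2 := neg_abs_le t
      have h3 := le_abs_self (C 0)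
      have h4 : |t| + |C 0| + 1 ≤ (|t| + |C 0| + 1) * T :=
        le_mul_of_one_le_right (by positivity) (by omega)
      rw [neg_mul]
      omega
    obtain ⟨a, ha, hmax⟩ := Int.exists_greatest_of_bdd hb hne
    exact ⟨a, fun i => ⟨fun h => (hC h).trans ha, hmax i⟩⟩
  choose α hα using hex
  exact ⟨α, fun i t => hα t i⟩

theorem map_getD_range (l : List ℕ) :
    (Multiset.range l.length).map (fun k => l.getD k 0) = (l : Multiset ℕ) := by
  rw [← Multiset.coe_range, Multiset.map_coe]
  congr 1
  refine List.ext_getElem (by simp) fun k h1 h2 => ?_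
  simp [h2]

/-! ### Construction of a dissection from its subgons at the boundary edges -/

/-- If the choice `p` of common elements is consistent with the multisets `A`, and the runs of
singletons are short, there is a sequence `s` of sizes of polygons lying side by side, with arcs
at the boundary vertices `α t` between them, whose incident sizes are given by `A`. -/
theorem exists_arcs (A : ℤ → Multiset ℕ) (hA3 : ∀ i, ∀ p ∈ A i, 3 ≤ p) (n : ℕ) (hn : 1 ≤ n)
    (hAper : ∀ i, A (i + n) = A i)
    (hskel : ∀ q : ℕ, 3 ≤ q → ∀ i : ℤ, ¬ ∀ k : ℕ, k < q - 2 → A (i + k) = {q})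
    (p : ℤ → ℕ) (hpper : ∀ i, p (i + n) = p i) (hpA : ∀ i, p i ∈ A i ∩ A (i + 1))
    (hp : ∀ i, 1 < (A i).card → p (i - 1) = p i → {p (i - 1), p i} ≤ A i) :
    ∃ (α : ℤ → ℤ) (s : ℤ → ℕ) (c : ℤ), Monotone α ∧ 0 < c ∧ (∀ t, α (t + c) = α t + n) ∧
      (∀ t, s (t + c) = s t) ∧ (∀ t, 3 ≤ s t) ∧ (∀ t, α (t + 1) - α t + 2 ≤ s t) ∧
      ∀ i, ∃ T : Finset ℤ, (∀ t, t ∈ T ↔ α t ≤ i ∧ i ≤ α (t + 1)) ∧ T.val.map s = A i := by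
  have hpm : ∀ i, p i ∈ A i := fun i => (Multiset.mem_inter.1 (hpA i)).1
  have hpm' : ∀ i, p (i - 1) ∈ A i := fun i => by
    have := (Multiset.mem_inter.1 (hpA (i - 1))).2
    rwa [sub_add_cancel] at this
  have hcardpos : ∀ i, 1 ≤ (A i).card := fun i => Multiset.card_pos_iff_exists_mem.2 ⟨_, hpm i⟩
  have hsingle : ∀ i, (A i).card = 1 → A i = {p i} ∧ p (i - 1) = p i := by
    intro i hi
    obtain ⟨a, ha⟩ := Multiset.card_eq_one.1 hi
    have h1 := hpm i
    have h2 := hpm' i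
    rw [ha, Multiset.mem_singleton] at h1 h2
    exact ⟨by rw [ha, h1], by rw [h1, h2]⟩
  have hpair : ∀ i, 1 < (A i).card → ({p (i - 1), p i} : Multiset ℕ) ≤ A i := by
    intro i hi
    by_cases heq : p (i - 1) = p i
    · exact hp i hi heq
    · rw [Multiset.le_iff_subset (by simpa using heq)]
      intro a ha
      rw [Multiset.insert_eq_cons, Multiset.mem_cons, Multiset.mem_singleton] at ha
      rcases ha with rfl | rfl
      · exact hpm' i
      · exact hpm i
  have hchain : ∀ (i : ℤ) (k : ℕ), (∀ j : ℤ, i < j → j ≤ i + k → (A j).card = 1) → p (i + k) = p i := by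
    intro i k
    induction k with
    | zero => intro _; simp
    | succ k ih =>
      intro h
      have h1 := (hsingle (i + (k + 1 : ℕ)) (h _ (by omega) le_rfl)).2
      rw [← h1, ← ih fun j hj hj' => h j hj (by push_cast; omega)]
      congr 1
      push_cast
      ring
  -- A vertex meeting `|A_i|` polygons carries `|A_i| - 1` arcs, so the arcs at `v_i` receive the
  -- numbers `C i ≤ t < C (i + 1)`.
  obtain ⟨C, hC⟩ := exists_partial_sums fun i => ((A i).card : ℤ) - 1
  have hCmono : Monotone C := monotone_partial_sums hC fun i => by have := hcardpos i; omega
  have hCper : ∀ i, C (i + n) = C i + (C n - C 0) :=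
    partial_sums_add_period hC fun i => by simp only [hAper]
  -- Without any arc, all `A i` would be the same singleton, against skeletality.
  have hTpos : 0 < C n - C 0 := by
    have h0 : C 0 ≤ C n := hCmono (by omega)
    by_contra hcon
    have hone : ∀ i, (A i).card = 1 := by
      have hle : ∀ i j : ℤ, C i ≤ C j := by
        intro i j
        have hmul : ∀ k : ℕ, C (j + k * n) = C j := by
          intro k
          induction k with
          | zero => simp
          | succ k ih =>
            have := hCper (j + k * n)
            have e : j + ((k + 1 : ℕ) : ℤ) * n = j + k * n + n := by push_cast; ring
            rw [e]
            omega
        have h1 := hmul (i - j).toNat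
        have h2 : i ≤ j + (i - j).toNat * n := by
          have : ((i - j).toNat : ℤ) * 1 ≤ (i - j).toNat * n := by
            gcongr
            omega
          omega
        rw [← h1]
        exact hCmono h2
      intro i
      have := hC i
      have := hle (i + 1) i
      have := hcardpos i
      omega
    refine hskel (p 0) (hA3 0 _ (hpm 0)) 0 fun k _ => ?_
    rw [(hsingle _ (hone _)).1, hchain 0 k fun j _ _ => hone j]
  -- The lower endpoint of arc `t` is the last vertex `i` with `C i ≤ t`; this skips the singleton
  -- vertices, which carry no arc.
  obtain ⟨α, hα⟩ := exists_upper_adjoint hCmono hTpos hCper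
  have hlow : ∀ t, C (α t) ≤ t := fun t => (hα _ _).1 le_rfl
  have hhigh : ∀ t, t < C (α t + 1) := fun t => by
    by_contra h
    have := (hα _ _).2 (not_lt.1 h)
    omega
  have hαmono : Monotone α := fun s t hst => (hα _ _).2 ((hlow s).trans hst)
  have hαper : ∀ t, α (t + (C n - C 0)) = α t + n := by
    intro t
    refine le_antisymm ?_ ?_
    · have h1 := hlow (t + (C n - C 0))
      have h2 := hCper (α (t + (C n - C 0)) - n)
      rw [sub_add_cancel] at h2
      have := (hα (α (t + (C n - C 0)) - n) t).2 (by omega)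
      omega
    · rw [hα, hCper]
      have := hlow t
      omega
  set L : ℤ → List ℕ := fun i => (A i - {p (i - 1), p i}).toList with hL
  have hLper : ∀ i, L (i + n) = L i := by
    intro i
    have e : i + n - 1 = i - 1 + (n : ℤ) := by ring
    simp only [hL, hAper, hpper, e]
  have hLlen : ∀ i, 1 < (A i).card → ((L i).length : ℤ) = (A i).card - 2 := by
    intro i hi
    simp only [hL, Multiset.length_toList]
    rw [Multiset.card_sub (hpair i hi), Multiset.card_pair]
    omega
  -- If `t` is the last arc at its vertex, polygon `t` contains the next boundary edge and its size
  -- is forced to be `p`. Otherwise it is a fan polygon, with size taken from the list `L`; the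
  -- default 0 is never reached.
  set s : ℤ → ℕ := fun t =>
    if t + 1 = C (α t + 1) then p (α t) else (L (α t)).getD (t - C (α t)).toNat 0 with hs
  have hs3 : ∀ t, 3 ≤ s t := by
    intro t
    have h1 := hlow t
    have h2 := hhigh t
    have h3 := hC (α t)
    simp only [hs]
    split_ifs with h
    · exact hA3 _ _ (hpm _)
    · have h4 := hLlen (α t) (by omega)
      have h5 : (t - C (α t)).toNat < (L (α t)).length := by omega
      rw [List.getD_eq_getElem _ _ h5]
      refine hA3 (α t) _ (Multiset.mem_of_le (Multiset.sub_le_self _ {p (α t - 1), p (α t)}) ?_)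
      rw [← Multiset.mem_toList]
      exact List.getElem_mem h5
  have hgap : ∀ t, t + 1 = C (α t + 1) → ∀ j, α t < j → C j ≤ t + 1 → p (j - 1) = p (α t) := by
    intro t ht j hj hCj
    have h := hchain (α t) (j - 1 - α t).toNat ?_
    · rw [← h]
      congr 1
      omega
    · intro k hk hk'
      have h1 := hC k
      have h2 : C (α t + 1) ≤ C k := hCmono (by omega)
      have h3 : C (k + 1) ≤ C j := hCmono (by omega)
      have := hcardpos k
      omega
  have hgap1 : ∀ t, t + 1 = C (α t + 1) → ∀ j, α t < j → j < α (t + 1) → A j = {p (α t)} := by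
    intro t ht j hj hj'
    have h1 := hC j
    have h2 : C (α t + 1) ≤ C j := hCmono (by omega)
    have h3 : C (j + 1) ≤ t + 1 := (hα _ _).1 (by omega)
    have h4 := hcardpos j
    rw [(hsingle j (by omega)).1, ← hgap t ht (j + 1) (by omega) h3, add_sub_cancel_right]
  refine ⟨α, s, C n - C 0, hαmono, hTpos, hαper, fun t => ?_, hs3, fun t => ?_, fun i => ?_⟩
  · have e : α t + n + 1 = α t + 1 + (n : ℤ) := by ring
    have e2 : t + (C n - C 0) - (C (α t) + (C n - C 0)) = t - C (α t) := by ring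
    simp only [hs, hαper, hpper, hLper, e, hCper, e2]
    congr 1
    rw [eq_iff_iff]
    omega
  · have h1 := hs3 t
    have h2 := hhigh t
    by_cases h : t + 1 = C (α t + 1)
    · have hst : s t = p (α t) := by simp only [hs]; rw [if_pos h]
      rw [hst] at h1 ⊢
      -- The vertices strictly between `α t` and `α (t + 1)` form a run of singletons `{p (α t)}`,
      -- of length at most `p (α t) - 3` by skeletality.
      by_contra hcon
      refine hskel (p (α t)) h1 (α t + 1) fun k hk => ?_
      exact hgap1 t h _ (by omega) (by omega)
    · have : α (t + 1) ≤ α t := by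
        by_contra hlt
        have := (hα (α t + 1) (t + 1)).1 (by omega)
        omega
      omega
  -- The lower bound is `C i - 1` because the polygon to the left of the first arc at `v_i` also
  -- meets `v_i`. For a singleton the interval is one point.
  · refine ⟨Finset.Icc (C i - 1) (C (i + 1) - 1), fun t => ?_, ?_⟩
    · rw [Finset.mem_Icc, hα]
      have : α t ≤ i ↔ ¬ C (i + 1) ≤ t := by rw [← hα]; omega
      rw [this]
      omega
    have hleft : s (C i - 1) = p (i - 1) := by
      have h1 := hlow (C i - 1)
      have h2 := hhigh (C i - 1)
      have h3 : α (C i - 1) < i := by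
        by_contra h
        have := hCmono (not_lt.1 h)
        omega
      have h4 : C (α (C i - 1) + 1) ≤ C i := hCmono (by omega)
      have h5 : C i - 1 + 1 = C (α (C i - 1) + 1) := by omega
      simp only [hs]
      rw [if_pos h5, hgap _ h5 i h3 (by omega)]
    have hi := hC i
    by_cases hcard : (A i).card = 1
    · have e : C (i + 1) - 1 = C i - 1 := by omega
      rw [e, Finset.Icc_self, Finset.singleton_val, Multiset.map_singleton, hleft,
        (hsingle i hcard).1, (hsingle i hcard).2]
    · have hc1 : 1 < (A i).card := by have := hcardpos i; omega
      have hlen := hLlen i hc1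
      have hαi : ∀ t, C i ≤ t → t < C (i + 1) → α t = i := by
        intro t h1 h2
        refine le_antisymm ?_ ((hα _ _).2 h1)
        by_contra h
        have := (hα (i + 1) t).1 (by omega)
        omega
      have hright : s (C (i + 1) - 1) = p i := by
        have h1 := hαi (C (i + 1) - 1) (by omega) (by omega)
        simp only [hs, h1]
        rw [if_pos (by omega)]
      have hmid : ∀ k : ℕ, k < (L i).length → s (C i + k) = (L i).getD k 0 := by
        intro k hk
        have h1 := hαi (C i + k) (by omega) (by omega)
        simp only [hs, h1]
        rw [if_neg (by omega)]
        congr 1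
        omega
      set M : Finset ℤ := (Finset.range (L i).length).map
        (Nat.castEmbedding.trans (addLeftEmbedding (C i))) with hM
      have hmemM : ∀ t, t ∈ M ↔ C i ≤ t ∧ t < C i + (L i).length := by
        intro t
        rw [hM, Finset.mem_map]
        constructor
        · rintro ⟨k, hk, rfl⟩
          have hk' := Finset.mem_range.1 hk
          change C i ≤ C i + (k : ℤ) ∧ C i + (k : ℤ) < C i + (L i).length
          omega
        · intro h
          refine ⟨(t - C i).toNat, Finset.mem_range.2 (by omega), ?_⟩
          change C i + ((t - C i).toNat : ℤ) = t
          omega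
      have hIcc : Finset.Icc (C i - 1) (C (i + 1) - 1) =
          insert (C i - 1) (insert (C (i + 1) - 1) M) := by
        ext t
        rw [Finset.mem_Icc, Finset.mem_insert, Finset.mem_insert, hmemM]
        omega
      have hn1 : C i - 1 ∉ insert (C (i + 1) - 1) M := by
        rw [Finset.mem_insert, hmemM]; omega
      have hn2 : C (i + 1) - 1 ∉ M := by
        rw [hmemM]; omega
      rw [hIcc, Finset.insert_val_of_notMem hn1, Finset.insert_val_of_notMem hn2, hM,
        Finset.map_val, Multiset.map_cons, Multiset.map_cons, Multiset.map_map, hleft, hright]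
      have hmap : Multiset.map (s ∘ fun k : ℕ => C i + (k : ℤ)) (Finset.range (L i).length).val =
          (L i : Multiset ℕ) := by
        rw [← map_getD_range, Finset.range_val]
        exact Multiset.map_congr rfl fun k hk => hmid k (Multiset.mem_range.1 hk)
      have hfin : (p (i - 1) ::ₘ p i ::ₘ (L i : Multiset ℕ)) = A i := by
        have h1 : (p (i - 1) ::ₘ p i ::ₘ (L i : Multiset ℕ)) = {p (i - 1), p i} + (L i : Multiset ℕ) := by
          simp
        rw [h1, hL, Multiset.coe_toList, add_tsub_cancel_of_le (hpair i hc1)]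
      rw [← hfin, ← hmap]
      rfl

end FriezeDissection

/-! ### The realizability criterion -/

open FriezeDissection in
theorem mainTheorem2 (S : Finset ℕ) (hS : ∀ p ∈ S, 3 ≤ p)
    (F : FriezeDissection.InfiniteFrieze ℝ) (hType : F.IsOfType S) (hSkel : F.IsSkeletal)
    (n : ℕ) (hn : 1 ≤ n) (hper : ∀ i, F.quiddity (i + n) = F.quiddity i)
    (A : ℤ → Multiset ℕ) (hA3 : ∀ i, ∀ p ∈ A i, 3 ≤ p)
    (hA : ∀ i, F.quiddity i = FriezeDissection.lamSum (A i)) :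
    F.IsRealizable n ↔
      FriezeDissection.PassesRealizabilityTest A ∧
      -- `p i` stands for `p_{i,i+1}`, with indices modulo `n`
      ∃ p : ℤ → ℕ, (∀ i, p (i + n) = p i) ∧
        (∀ i, p i ∈ A i ∩ A (i + 1)) ∧
        ∀ i, 1 < (A i).card → p (i - 1) = p i → {p (i - 1), p i} ≤ A i := by
  have hskel : ∀ q : ℕ, 3 ≤ q → ∀ i : ℤ, ¬ ∀ k : ℕ, k < q - 2 → A (i + k) = {q} := by
    intro q hq i h
    refine hSkel q hq i fun k hk => ?_
    rw [hA, h k hk, lamSum, Multiset.map_singleton, Multiset.sum_singleton]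
  constructor
  · intro hreal
    have hex : ∃ p : ℤ → ℕ, (∀ i, p (i + n) = p i) ∧ (∀ i, p i ∈ A i ∩ A (i + 1)) ∧
        ∀ i, 1 < (A i).card → {p (i - 1), p i} ≤ A i := by
      rcases hreal with ⟨m, -, D, hD⟩ | ⟨D, hD⟩
      · refine D.exists_sizes_at_edges hn A fun i => ?_
        obtain ⟨B, hB, hq⟩ := hD i
        -- Linear independence identifies the actual subgon sizes with the given multiset.
        rwa [lamSum_injOn (hA3 i) (three_le_of_hasSubgonSizes hB) ((hA i).symm.trans hq)]
      · refine D.exists_sizes_at_edges hn A fun i => ?_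
        obtain ⟨B, hB, hq⟩ := hD i
        rwa [lamSum_injOn (hA3 i) (three_le_of_hasSubgonSizes hB) ((hA i).symm.trans hq)]
    obtain ⟨p, h1, h2, h3⟩ := hex
    refine ⟨⟨?_, ?_⟩, p, h1, h2, fun i hi _ => h3 i hi⟩
    · rintro ⟨i, hi⟩
      have := h2 i
      rw [hi] at this
      exact Multiset.notMem_zero _ this
    · rintro ⟨q, hq, ⟨i, hi⟩, -⟩
      exact hskel q hq i fun k hk => hi k (by omega)
  · rintro ⟨-, p, hpper, hpA, hp⟩
    have hAper : ∀ i, A (i + n) = A i := fun i =>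
      lamSum_injOn (hA3 _) (hA3 _) (by rw [← hA, ← hA, hper])
    obtain ⟨α, s, c, hα, hc, hαc, hsc, hs3, hsα, hT⟩ :=
      exists_arcs A hA3 n hn hAper hskel p hpper hpA hp
    -- If lower edges and bridging sides exhaust every polygon, all upper vertices merge into the
    -- puncture.
    by_cases hzero : ∀ t, (s t : ℤ) = (α (t + 1) - α t) + 2
    · refine Or.inr ⟨puncturedOfArcs c hαc, fun i => ?_⟩
      obtain ⟨T, hT1, hT2⟩ := hT i
      exact ⟨A i, hT2 ▸ puncturedOfArcs_sizesAt hα c hαc s hs3 hzero i T hT1, hA i⟩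
    · push Not at hzero
      obtain ⟨t₀, ht₀⟩ := hzero
      -- The summand is the number of inner boundary edges still needed by polygon `t`. The total
      -- over one period is `m`, which is positive since polygon `t₀` needs at least one.
      obtain ⟨β, hβ⟩ := exists_partial_sums fun t => (s t : ℤ) - 2 - (α (t + 1) - α t)
      have hβmono : Monotone β := monotone_partial_sums hβ fun t => by have := hsα t; omega
      have hβper := partial_sums_add_period (n := c) hβ fun t => by
        have e : t + c + 1 = t + 1 + c := by ring
        rw [hsc, e, hαc, hαc]
        ring
      have hpos : 0 < β c - β 0 := by
        have h1 := hβper t₀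
        have h2 := hβ t₀
        have h3 : β (t₀ + 1) ≤ β (t₀ + c) := hβmono (by omega)
        have h4 := hsα t₀
        omega
      have hβc : ∀ t, β (t + c) = β t + ((β c - β 0).toNat : ℕ) := fun t => by
        rw [hβper, Int.toNat_of_nonneg hpos.le]
      refine Or.inl ⟨(β c - β 0).toNat, by omega, annulusOfArcs hα hβmono c hαc hβc, fun i => ?_⟩
      obtain ⟨T, hT1, hT2⟩ := hT i
      refine ⟨A i, hT2 ▸ annulusOfArcs_sizesAt hα hβmono c hαc hβc s hs3 (fun t => ?_) i T hT1,
        hA i⟩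
      have := hβ t
      omega
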